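/- Let $\mathbb{K}$ be $\mathbb{R}$ or $\mathbb{C}$. Let $\mathfrak{B}_4 = (\mathfrak{W}\oplus\overline{\mathfrak{W}})\ltimes V_4$ be the four-dimensional BMS algebra, i.e. the Lie algebra over $\mathbb{K}$ with basis $l_m, \bar l_m, T_{pq}$ ($m,p,q\in\mathbb{Z}$) and brackets $$[l_m,l_n]=(m-n)\,l_{m+n},\qquad [\bar l_m,\bar l_n]=(m-n)\,\bar l_{m+n},\qquad [l_m,\bar l_n]=[T_{mn},T_{pq}]=0,$$ $$[l_m,T_{pq}]=\Big(\tfrac{m+1}{2}-p\Big)T_{m+p,q},\qquad [\bar l_m,T_{pq}]=\Big(\tfrac{m+1}{2}-q\Big)T_{p,q+m}.$$ Let $\bigwedge^n\mathfrak{B}_4$ carry the adjoint action extended by derivations. A Lie bialgebra structure on $\mathfrak{B}_4$ is a linear map $\delta:\mathfrak{B}_4\to\bigwedge^2\mathfrak{B}_4$ that is a 1-cocycle, $\delta([x,y])=x\cdot\delta(y)-y\cdot\delta(x)$, and satisfies the co-Jacobi identity $\mathrm{Cycl}\big((\delta\otimes\mathrm{id})\delta(x)\big)=0$, where $x\wedge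 y$ is identified with $x\otimes y-y\otimes x$. For $r\in\bigwedge^2\mathfrak{B}_4$ put $\delta_r(x)=x\cdot r=[x\otimes 1+1\otimes x,r]$ and $[[r,r]]=[r_{12},r_{13}]+[r_{12},r_{23}]+[r_{13},r_{23}]$; call $r$ triangular if $[[r,r]]=0$. Then: 1. $H^1(\mathfrak{B}_4,\bigwedge^2\mathfrak{B}_4)=0$. 2. The only ad-invariant element of $\bigwedge^2\mathfrak{B}_4$ is $0$, and the only ad-invariant element of $\bigwedge^3\mathfrak{B}_4$ is $0$. 3. Every Lie bialgebra structure on $\mathfrak{B}_4$ is coboundary and triangular: it equals $\delta_r$ for a unique $r\in\bigwedge^2\mathfrak{B}_4$, and this $r$ satisfies $[[r,r]]=0$. Conversely, $\delta_r$ is a Lie bialgebra structure for every triangular $r$. 4. For triangular $r_1,r_2$, the Lie bialgebras $(\mathfrak{B}_4,\delta_{r_1})$ and $(\mathfrak{B}_4,\delta_{r_2})$ are isomorphic if and only if $r_2=(\phi\otimes\phi)(r_1)$ for some Lie algebra automorphism $\phi$ of $\mathfrak{B}_4$. -/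

import Mathlib

open scoped TensorProduct

noncomputable section

/-! ### The four-dimensional BMS algebra -/

/-- The generators `l_m`, `l̄_m` and `T_{pq}`, with all indices running over `ℤ`. -/
inductive BMS4.Gen : Type
  | l (m : ℤ) : BMS4.Gen
  | lbar (m : ℤ) : BMS4.Gen
  | T (p q : ℤ) : BMS4.Gen

/-- The underlying space of the four-dimensional BMS algebra: the free vector space on the
generators. -/
def BMS4 (𝕜 : Type*) [Field 𝕜] : Type _ := BMS4.Gen →₀ 𝕜

namespace BMS4

variable (𝕜 : Type*) [Field 𝕜]

instance : AddCommGroup (BMS4 𝕜) := inferInstanceAs (AddCommGroup (Gen →₀ 𝕜))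

instance : Module 𝕜 (BMS4 𝕜) := inferInstanceAs (Module 𝕜 (Gen →₀ 𝕜))

/-- The basis of the BMS algebra given by the generators. -/
def basis : Module.Basis Gen 𝕜 (BMS4 𝕜) := ⟨LinearEquiv.refl 𝕜 (Gen →₀ 𝕜)⟩

/-- The superrotation `l_m`. -/
def l (m : ℤ) : BMS4 𝕜 := basis 𝕜 (Gen.l m)

/-- The superrotation `l̄_m`. -/
def lbar (m : ℤ) : BMS4 𝕜 := basis 𝕜 (Gen.lbar m)

/-- The supertranslation `T_{pq}`. -/
def T (p q : ℤ) : BMS4 𝕜 := basis 𝕜 (Gen.T p q)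

/-- The bracket of two generators. -/
def genBracket : Gen → Gen → BMS4 𝕜
  | .l m, .l n => ((m : 𝕜) - n) • l 𝕜 (m + n)
  | .l _, .lbar _ => 0
  | .l m, .T p q => (((m : 𝕜) + 1) / 2 - p) • T 𝕜 (m + p) q
  | .lbar _, .l _ => 0
  | .lbar m, .lbar n => ((m : 𝕜) - n) • lbar 𝕜 (m + n)
  | .lbar m, .T p q => (((m : 𝕜) + 1) / 2 - q) • T 𝕜 p (q + m)
  | .T p q, .l m => -((((m : 𝕜) + 1) / 2 - p) • T 𝕜 (m + p) q)
  | .T p q, .lbar m => -((((m : 𝕜) + 1) / 2 - q) • T 𝕜 p (q + m))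
  | .T _ _, .T _ _ => 0

/-- The bilinear extension of the bracket of generators. -/
def bracketBilin : BMS4 𝕜 →ₗ[𝕜] BMS4 𝕜 →ₗ[𝕜] BMS4 𝕜 :=
  (basis 𝕜).constr 𝕜 fun a => (basis 𝕜).constr 𝕜 fun b => genBracket 𝕜 a b

theorem bracketBilin_basis (a b : Gen) :
    bracketBilin 𝕜 (basis 𝕜 a) (basis 𝕜 b) = genBracket 𝕜 a b := by
  simp [bracketBilin, Module.Basis.constr_basis]

theorem bracketBilin_skew (x y : BMS4 𝕜) : bracketBilin 𝕜 x y = -bracketBilin 𝕜 y x := by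
  have h : bracketBilin 𝕜 = -(bracketBilin 𝕜).flip := by
    refine (basis 𝕜).ext fun a => (basis 𝕜).ext fun b => ?_
    simp only [LinearMap.neg_apply, LinearMap.flip_apply, bracketBilin_basis]
    cases a <;> cases b <;> simp [genBracket, add_comm, ← neg_smul]
  exact LinearMap.congr_fun (LinearMap.congr_fun h x) y

theorem bracketBilin_self [CharZero 𝕜] (x : BMS4 𝕜) : bracketBilin 𝕜 x x = 0 := by
  have h := bracketBilin_skew 𝕜 x x
  have h2 : (2 : 𝕜) • bracketBilin 𝕜 x x = 0 := by
    rw [two_smul]; nth_rewrite 1 [h]; exact neg_add_cancel _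
  exact (smul_eq_zero.mp h2).resolve_left two_ne_zero

theorem bracketBilin_jacobi [CharZero 𝕜] (x y z : BMS4 𝕜) :
    bracketBilin 𝕜 x (bracketBilin 𝕜 y z) =
      bracketBilin 𝕜 (bracketBilin 𝕜 x y) z + bracketBilin 𝕜 y (bracketBilin 𝕜 x z) := by
  have key : ∀ a b c : Gen,
      bracketBilin 𝕜 (basis 𝕜 a) (genBracket 𝕜 b c) =
        bracketBilin 𝕜 (genBracket 𝕜 a b) (basis 𝕜 c) +
          bracketBilin 𝕜 (basis 𝕜 b) (genBracket 𝕜 a c) := by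
    intro a b c
    cases a <;> cases b <;> cases c <;>
      simp only [genBracket, l, lbar, T, map_smul, map_neg, map_zero, LinearMap.smul_apply,
        LinearMap.neg_apply, LinearMap.zero_apply, bracketBilin_basis, smul_smul, smul_neg,
        neg_neg, smul_zero, neg_zero, add_zero, zero_add] <;>
      (try simp only [← neg_smul, ← add_smul, add_comm, add_left_comm])
    all_goals first
      | rfl
      | (symm; apply smul_eq_zero_of_left; ring1)
      | (congr 1; push_cast; ring1)
  have hx := (basis 𝕜).mem_span x
  have hy := (basis 𝕜).mem_span y
  have hz := (basis 𝕜).mem_span z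
  induction hx using Submodule.span_induction with
  | zero => simp
  | add u v _ _ hu hv => simp only [map_add, LinearMap.add_apply, hu, hv]; abel
  | smul c u _ hu => simp only [map_smul, LinearMap.smul_apply, hu, smul_add]
  | mem u hu =>
    obtain ⟨a, rfl⟩ := hu
    induction hy using Submodule.span_induction with
    | zero => simp
    | add u v _ _ hu hv => simp only [map_add, LinearMap.add_apply, hu, hv]; abel
    | smul c u _ hu => simp only [map_smul, LinearMap.smul_apply, hu, smul_add]
    | mem u hu =>
      obtain ⟨b, rfl⟩ := hu
      induction hz using Submodule.span_induction with
      | zero => simp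
      | add u v _ _ hu hv => simp only [map_add, hu, hv]; abel
      | smul c u _ hu => simp only [map_smul, hu, smul_add]
      | mem u hu =>
        obtain ⟨c, rfl⟩ := hu
        rw [bracketBilin_basis, bracketBilin_basis, bracketBilin_basis]
        exact key a b c

instance [CharZero 𝕜] : LieRing (BMS4 𝕜) where
  bracket x y := bracketBilin 𝕜 x y
  add_lie x y z := by
    change bracketBilin 𝕜 (x + y) z = bracketBilin 𝕜 x z + bracketBilin 𝕜 y z
    simp
  lie_add x y z := (bracketBilin 𝕜 x).map_add y z
  lie_self x := bracketBilin_self 𝕜 x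
  leibniz_lie x y z := bracketBilin_jacobi 𝕜 x y z

instance [CharZero 𝕜] : LieAlgebra 𝕜 (BMS4 𝕜) where
  lie_smul c x y := (bracketBilin 𝕜 x).map_smul c y

variable [CharZero 𝕜]

theorem lie_l_l (m n : ℤ) : ⁅l 𝕜 m, l 𝕜 n⁆ = ((m : 𝕜) - n) • l 𝕜 (m + n) :=
  bracketBilin_basis 𝕜 _ _

theorem lie_lbar_lbar (m n : ℤ) : ⁅lbar 𝕜 m, lbar 𝕜 n⁆ = ((m : 𝕜) - n) • lbar 𝕜 (m + n) :=
  bracketBilin_basis 𝕜 _ _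

theorem lie_l_lbar (m n : ℤ) : ⁅l 𝕜 m, lbar 𝕜 n⁆ = 0 :=
  bracketBilin_basis 𝕜 _ _

theorem lie_l_T (m p q : ℤ) : ⁅l 𝕜 m, T 𝕜 p q⁆ = (((m : 𝕜) + 1) / 2 - p) • T 𝕜 (m + p) q :=
  bracketBilin_basis 𝕜 _ _

theorem lie_lbar_T (m p q : ℤ) :
    ⁅lbar 𝕜 m, T 𝕜 p q⁆ = (((m : 𝕜) + 1) / 2 - q) • T 𝕜 p (q + m) :=
  bracketBilin_basis 𝕜 _ _

theorem lie_T_T (m n p q : ℤ) : ⁅T 𝕜 m n, T 𝕜 p q⁆ = 0 :=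
  bracketBilin_basis 𝕜 _ _

end BMS4

/-! ### Exterior powers of a Lie module -/

namespace ExtPowLie

section

variable (R : Type*) [CommRing R] {M : Type*} [AddCommGroup M] [Module R M] (n : ℕ)

theorem sum_update_eq_zero (f : M → M) (v : Fin n → M) (i j : Fin n) (hv : v i = v j)
    (hij : i ≠ j) :
    ∑ k, exteriorPower.ιMulti R n (Function.update v k (f (v k))) = 0 := by
  rw [← Finset.sum_subset (Finset.subset_univ {i, j}), Finset.sum_pair hij]
  · have hsw : Function.update v j (f (v j)) =
        Function.update v i (f (v i)) ∘ Equiv.swap i j := by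
      funext k
      rcases eq_or_ne k i with rfl | hki
      · rw [Function.comp_apply, Equiv.swap_apply_left, Function.update_of_ne hij,
          Function.update_of_ne (Ne.symm hij), hv]
      · rcases eq_or_ne k j with rfl | hkj
        · simp [hv]
        · simp [Equiv.swap_apply_of_ne_of_ne hki hkj, hki, hkj]
    rw [hsw, AlternatingMap.map_swap _ _ hij, add_neg_cancel]
  · intro k _ hk
    simp only [Finset.mem_insert, Finset.mem_singleton, not_or] at hk
    refine AlternatingMap.map_eq_zero_of_eq _ _ (i := i) (j := j) ?_ hij
    rw [Function.update_of_ne (Ne.symm hk.1), Function.update_of_ne (Ne.symm hk.2), hv]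

theorem ite_comp_eq_update (f : Module.End R M) (v : Fin n → M) (i : Fin n) :
    (fun j => (if j = i then f else LinearMap.id) (v j)) = Function.update v i (f (v i)) := by
  funext j
  rcases eq_or_ne j i with rfl | h
  · simp
  · simp [h]

/-- For an endomorphism `f`, the alternating map
`(v₁, …, vₙ) ↦ ∑ i, v₁ ∧ ⋯ ∧ f vᵢ ∧ ⋯ ∧ vₙ`. -/
def derivAlt (f : Module.End R M) : M [⋀^Fin n]→ₗ[R] ⋀[R]^n M where
  toMultilinearMap := ∑ i, (exteriorPower.ιMulti R n (M := M)).toMultilinearMap.compLinearMap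
    (fun j => if j = i then f else LinearMap.id)
  map_eq_zero_of_eq' v i j hv hij := by
    rw [← sum_update_eq_zero R n f v i j hv hij]
    simp only [sum_apply, MultilinearMap.compLinearMap_apply,
      MultilinearMap.toFun_eq_coe, ite_comp_eq_update]
    rfl

theorem derivAlt_apply (f : Module.End R M) (v : Fin n → M) :
    derivAlt R n f v = ∑ i, exteriorPower.ιMulti R n (Function.update v i (f (v i))) := by
  change (∑ i, (exteriorPower.ιMulti R n (M := M)).toMultilinearMap.compLinearMap
    (fun j => if j = i then f else LinearMap.id)) v = _
  simp only [sum_apply, MultilinearMap.compLinearMap_apply, ite_comp_eq_update]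
  rfl

/-- The derivation of the exterior power induced by an endomorphism. -/
def deriv (f : Module.End R M) : Module.End R (⋀[R]^n M) :=
  exteriorPower.alternatingMapLinearEquiv (derivAlt R n f)

theorem deriv_ιMulti (f : Module.End R M) (v : Fin n → M) :
    deriv R n f (exteriorPower.ιMulti R n v) =
      ∑ i, exteriorPower.ιMulti R n (Function.update v i (f (v i))) := by
  rw [deriv, exteriorPower.alternatingMapLinearEquiv_apply_ιMulti, derivAlt_apply]

theorem deriv_add (f g : Module.End R M) : deriv R n (f + g) = deriv R n f + deriv R n g := by
  refine exteriorPower.linearMap_ext (AlternatingMap.ext fun v => ?_)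
  simp [deriv_ιMulti, Finset.sum_add_distrib]

theorem deriv_smul (c : R) (f : Module.End R M) : deriv R n (c • f) = c • deriv R n f := by
  refine exteriorPower.linearMap_ext (AlternatingMap.ext fun v => ?_)
  simp [deriv_ιMulti, Finset.smul_sum]

theorem deriv_commutator (f g : Module.End R M) :
    deriv R n (f * g - g * f) = deriv R n f * deriv R n g - deriv R n g * deriv R n f := by
  refine exteriorPower.linearMap_ext (AlternatingMap.ext fun v => ?_)
  have h : ∀ f g : Module.End R M, deriv R n f (deriv R n g (exteriorPower.ιMulti R n v)) =
      ∑ i, exteriorPower.ιMulti R n (Function.update v i (f (g (v i)))) +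
      ∑ i, ∑ j ∈ Finset.univ.erase i, exteriorPower.ιMulti R n
        (Function.update (Function.update v i (g (v i))) j (f (v j))) := by
    intro f g
    rw [deriv_ιMulti, map_sum, ← Finset.sum_add_distrib]
    refine Finset.sum_congr rfl fun i _ => ?_
    rw [deriv_ιMulti, ← Finset.add_sum_erase _ _ (Finset.mem_univ i)]
    congr 1
    · simp
    · refine Finset.sum_congr rfl fun j hj => ?_
      rw [Function.update_of_ne (Finset.ne_of_mem_erase hj)]
  have hsymm : ∑ i, ∑ j ∈ Finset.univ.erase i, exteriorPower.ιMulti R n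
        (Function.update (Function.update v i (g (v i))) j (f (v j))) =
      ∑ i, ∑ j ∈ Finset.univ.erase i, exteriorPower.ιMulti R n
        (Function.update (Function.update v i (f (v i))) j (g (v j))) := by
    rw [Finset.sum_comm' (t' := Finset.univ) (s' := fun j => Finset.univ.erase j)
      (by intro i j; simp [eq_comm])]
    refine Finset.sum_congr rfl fun i _ => Finset.sum_congr rfl fun j hj => ?_
    rw [Function.update_comm (Finset.ne_of_mem_erase hj)]
  simp only [LinearMap.compAlternatingMap_apply, LinearMap.sub_apply,
    Module.End.mul_apply]
  rw [h, h, hsymm, deriv_ιMulti]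
  simp only [LinearMap.sub_apply, Module.End.mul_apply, AlternatingMap.map_update_sub,
    Finset.sum_sub_distrib]
  abel

end

variable (R : Type*) [CommRing R] {L : Type*} [LieRing L] [LieAlgebra R L]
variable {M : Type*} [AddCommGroup M] [Module R M] [LieRingModule L M] [LieModule R L M] (n : ℕ)

/-- The action of a Lie algebra on the exterior powers of a module, by derivations. -/
instance : LieRingModule L (⋀[R]^n M) where
  bracket x m := deriv R n (LieModule.toEnd R L M x) m
  add_lie x y m := by
    change deriv R n _ m = deriv R n _ m + deriv R n _ m
    rw [map_add, deriv_add, LinearMap.add_apply]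
  lie_add x m m' := map_add _ m m'
  leibniz_lie x y m := by
    change deriv R n _ (deriv R n _ m) = deriv R n _ m + deriv R n _ (deriv R n _ m)
    have h : LieModule.toEnd R L M ⁅x, y⁆ = LieModule.toEnd R L M x * LieModule.toEnd R L M y -
        LieModule.toEnd R L M y * LieModule.toEnd R L M x := by
      ext m
      simp
    rw [h, deriv_commutator, LinearMap.sub_apply, Module.End.mul_apply, Module.End.mul_apply,
      sub_add_cancel]

instance : LieModule R L (⋀[R]^n M) where
  smul_lie c x m := by
    change deriv R n _ m = c • deriv R n _ m
    rw [map_smul, deriv_smul, LinearMap.smul_apply]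
  lie_smul c x m := map_smul _ c m

/-- `x · (v₁ ∧ ⋯ ∧ vₙ) = ∑ i, v₁ ∧ ⋯ ∧ [x, vᵢ] ∧ ⋯ ∧ vₙ`. -/
theorem lie_ιMulti (x : L) (v : Fin n → M) :
    ⁅x, exteriorPower.ιMulti R n v⁆ =
      ∑ i, exteriorPower.ιMulti R n (Function.update v i ⁅x, v i⁆) :=
  deriv_ιMulti R n _ v

end ExtPowLie

/-! ### The first cohomology of a Lie algebra -/

namespace LieH1

open LieModule.Cohomology

variable (R : Type*) [CommRing R] (L : Type*) [LieRing L] [LieAlgebra R L]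
variable (M : Type*) [AddCommGroup M] [Module R M] [LieRingModule L M] [LieModule R L M]

/-- The coboundary operator from 0-cochains to 1-cochains, `r ↦ (x ↦ x · r)`. -/
def d₀₁ : M →ₗ[R] oneCochain R L M := (LieModule.toEnd R L M : L →ₗ[R] Module.End R M).flip

@[simp]
theorem d₀₁_apply (r : M) (x : L) : d₀₁ R L M r x = ⁅x, r⁆ := rfl

/-- The 1-cocycles: linear maps `δ : L → M` with `δ [x, y] = x · δ y - y · δ x`. -/
def oneCocycle : Submodule R (oneCochain R L M) := LinearMap.ker (d₁₂ R L M)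

/-- The 1-coboundaries. -/
def oneCoboundary : Submodule R (oneCochain R L M) := LinearMap.range (d₀₁ R L M)

theorem mem_oneCocycle_iff (δ : oneCochain R L M) :
    δ ∈ oneCocycle R L M ↔ ∀ x y, δ ⁅x, y⁆ = ⁅x, δ y⁆ - ⁅y, δ x⁆ := by
  rw [oneCocycle, LinearMap.mem_ker]
  constructor
  · intro h x y
    have h1 : d₁₂ R L M δ x y = 0 := by rw [h]; rfl
    rw [d₁₂_apply_apply, sub_eq_zero] at h1
    exact h1.symm
  · intro h
    apply Subtype.ext
    ext x y
    change d₁₂ R L M δ x y = 0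
    rw [d₁₂_apply_apply, h, sub_self]

theorem oneCoboundary_le_oneCocycle : oneCoboundary R L M ≤ oneCocycle R L M := by
  rintro _ ⟨r, rfl⟩
  rw [mem_oneCocycle_iff]
  intro x y
  simp [lie_lie]

/-- The first cohomology group `H¹(L, M)`: 1-cocycles modulo 1-coboundaries. -/
abbrev H1 : Type _ := oneCocycle R L M ⧸ (oneCoboundary R L M).submoduleOf (oneCocycle R L M)

end LieH1

/-! ### Lie bialgebras -/

namespace LieBialg

variable (R : Type*) [CommRing R] (L : Type*) [LieRing L] [LieAlgebra R L]

/-- The inclusion of bivectors into tensors, `x ∧ y ↦ x ⊗ y - y ⊗ x`. -/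
def toTensor : ⋀[R]^2 L →ₗ[R] L ⊗[R] L :=
  exteriorPower.alternatingMapLinearEquiv
    { toFun := fun v => v 0 ⊗ₜ[R] v 1 - v 1 ⊗ₜ[R] v 0
      map_update_add' := by
        intro _ v i x y
        fin_cases i <;>
          simp [TensorProduct.add_tmul, TensorProduct.tmul_add] <;> abel
      map_update_smul' := by
        intro _ v i c x
        fin_cases i <;>
          simp [TensorProduct.smul_tmul', smul_sub]
      map_eq_zero_of_eq' := by
        intro v i j hv hij
        have h : v 0 = v 1 := by
          fin_cases i <;> fin_cases j <;> simp_all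
        simp [h] }

theorem toTensor_ιMulti (v : Fin 2 → L) :
    toTensor R L (exteriorPower.ιMulti R 2 v) = v 0 ⊗ₜ[R] v 1 - v 1 ⊗ₜ[R] v 0 := by
  rw [toTensor, exteriorPower.alternatingMapLinearEquiv_apply_ιMulti]
  rfl

/-- The cyclic rotation `a ⊗ b ⊗ c ↦ c ⊗ a ⊗ b`. -/
def rot : (L ⊗[R] L) ⊗[R] L →ₗ[R] (L ⊗[R] L) ⊗[R] L :=
  (TensorProduct.assoc R L L L).symm.toLinearMap ∘ₗ
    (TensorProduct.comm R (L ⊗[R] L) L).toLinearMap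

theorem rot_tmul (a b c : L) : rot R L ((a ⊗ₜ[R] b) ⊗ₜ[R] c) = (c ⊗ₜ[R] a) ⊗ₜ[R] b := rfl

/-- The sum over cyclic rotations. -/
def cycl : (L ⊗[R] L) ⊗[R] L →ₗ[R] (L ⊗[R] L) ⊗[R] L :=
  LinearMap.id + rot R L + rot R L ∘ₗ rot R L

variable {R L}

/-- `δ : L → ⋀² L` is a Lie bialgebra structure on `L`: it is a 1-cocycle, and it satisfies the
co-Jacobi identity `Cycl ((δ ⊗ id) (δ x)) = 0`. -/
structure IsCobracket (δ : L →ₗ[R] ⋀[R]^2 L) : Prop where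
  cocycle : ∀ x y, δ ⁅x, y⁆ = ⁅x, δ y⁆ - ⁅y, δ x⁆
  coJacobi : ∀ x,
    cycl R L ((toTensor R L ∘ₗ δ).rTensor L (toTensor R L (δ x))) = 0

/-- Two cobrackets on `L` define isomorphic Lie bialgebras: they are intertwined by a Lie algebra
automorphism of `L`. -/
def Isomorphic (δ₁ δ₂ : L →ₗ[R] ⋀[R]^2 L) : Prop :=
  ∃ φ : L ≃ₗ⁅R⁆ L, ∀ x, exteriorPower.map 2 (φ : L →ₗ[R] L) (δ₁ x) = δ₂ (φ x)

/-- The coboundary cobracket `δ_r(x) = x · r = [x ⊗ 1 + 1 ⊗ x, r]`. -/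
def cobracketOf (r : ⋀[R]^2 L) : L →ₗ[R] ⋀[R]^2 L := LieH1.d₀₁ R L (⋀[R]^2 L) r

variable (R L)

/-- The Lie bracket as a linear map `L ⊗ L → L`. -/
def bracketMap : L ⊗[R] L →ₗ[R] L := (LieModule.toModuleHom R L L : L ⊗[R] L →ₗ[R] L)

/-- `(a ⊗ b) ⊗ (a' ⊗ b') ↦ [a, a'] ⊗ b ⊗ b'`, that is `[r₁₂, r'₁₃]`. -/
def br1213 : (L ⊗[R] L) ⊗[R] (L ⊗[R] L) →ₗ[R] (L ⊗[R] L) ⊗[R] L :=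
  (TensorProduct.assoc R L L L).symm.toLinearMap ∘ₗ (bracketMap R L).rTensor (L ⊗[R] L) ∘ₗ
    (TensorProduct.tensorTensorTensorComm R L L L L).toLinearMap

/-- `(a ⊗ b) ⊗ (a' ⊗ b') ↦ a ⊗ [b, a'] ⊗ b'`, that is `[r₁₂, r'₂₃]`. -/
def br1223 : (L ⊗[R] L) ⊗[R] (L ⊗[R] L) →ₗ[R] (L ⊗[R] L) ⊗[R] L :=
  (TensorProduct.assoc R L L L).symm.toLinearMap ∘ₗ
    ((bracketMap R L).rTensor L ∘ₗ (TensorProduct.assoc R L L L).symm.toLinearMap).lTensor L ∘ₗ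
      (TensorProduct.assoc R L L (L ⊗[R] L)).toLinearMap

/-- `(a ⊗ b) ⊗ (a' ⊗ b') ↦ a ⊗ a' ⊗ [b, b']`, that is `[r₁₃, r'₂₃]`. -/
def br1323 : (L ⊗[R] L) ⊗[R] (L ⊗[R] L) →ₗ[R] (L ⊗[R] L) ⊗[R] L :=
  (bracketMap R L).lTensor (L ⊗[R] L) ∘ₗ
    (TensorProduct.tensorTensorTensorComm R L L L L).toLinearMap

theorem br1213_tmul (a b a' b' : L) :
    br1213 R L ((a ⊗ₜ[R] b) ⊗ₜ[R] (a' ⊗ₜ[R] b')) = (⁅a, a'⁆ ⊗ₜ[R] b) ⊗ₜ[R] b' := rfl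

theorem br1223_tmul (a b a' b' : L) :
    br1223 R L ((a ⊗ₜ[R] b) ⊗ₜ[R] (a' ⊗ₜ[R] b')) = (a ⊗ₜ[R] ⁅b, a'⁆) ⊗ₜ[R] b' := rfl

theorem br1323_tmul (a b a' b' : L) :
    br1323 R L ((a ⊗ₜ[R] b) ⊗ₜ[R] (a' ⊗ₜ[R] b')) = (a ⊗ₜ[R] a') ⊗ₜ[R] ⁅b, b'⁆ := rfl

variable {R L}

/-- The Schouten bracket `[[r, r]] = [r₁₂, r₁₃] + [r₁₂, r₂₃] + [r₁₃, r₂₃]` of a bivector. -/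
def schouten (r : ⋀[R]^2 L) : (L ⊗[R] L) ⊗[R] L :=
  (br1213 R L + br1223 R L + br1323 R L) (toTensor R L r ⊗ₜ[R] toTensor R L r)

/-- `r` is a triangular r-matrix: it solves the classical Yang-Baxter equation `[[r, r]] = 0`. -/
def IsTriangular (r : ⋀[R]^2 L) : Prop := schouten r = 0

end LieBialg

end

/-! Everything rests on finite support. Each `l_m` or `l̄_m` sends a generator to a multiple of a
shifted generator. If a nonzero tensor of positive degree were invariant, take a tuple in its
support and apply `l_m` or `l̄_m` with `m` large, whichever moves one of its entries. The shifted
tuple lies outside the support and can arise from no other term, and its coefficient is nonzero. So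
there are no invariants in exterior powers of positive degree or in the tensor cube
(`eq_zero_of_killed`).

For `H¹`, let `δ` be a cocycle. Since `[l_m, l̄_n] = 0`, `l_m · δ(l̄_n) = l̄_n · δ(l_m)`. Reading
this far out in the `l̄` direction exhibits the mixed part of `δ(l_m)` as a coboundary
(`IsBicocycle.exists_primitive`). Once that is subtracted, the absence of invariants forces `δ(l_m)`
into bivectors in the `l_i` and `δ(l̄_m)` into bivectors in the `l̄_i`. Each piece is a cocycle of a
Witt algebra `W` with values in `⋀²W`, and `H¹(W, ⋀²W) = 0` is computed by hand
(`Witt.IsCocycle.exists_eq_act`). What remains vanishes on both Witt algebras, hence is equivariant.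
Weights under `l_0` and `l̄_0` leave only components `T ∧ l` and `T ∧ l̄` in `δ(T)`, and these
vanish by `eq_zero_of_equivariant`.

So every cobracket is some `δ_r`, with `r` unique because there are no invariant bivectors.
Drinfeld's identity (`cycl_cobracketOf`) turns co-Jacobi into invariance of `[[r, r]]`, which must
then be zero. Likewise `φ` intertwines `δ_{r₁}` and `δ_{r₂}` exactly when `φ(r₁) - r₂` is invariant,
that is, zero. -/

/-! ### Coordinates on exterior powers -/

namespace exteriorPower

variable {R M I : Type*} [CommRing R] [AddCommGroup M] [Module R M] (b : Module.Basis I R M)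

/-- The coordinate `(a₁, …, aₙ)` of an `n`-vector with respect to a basis: on `v₁ ∧ ⋯ ∧ vₙ` it is
the determinant of the coordinates of the `vᵢ` at the `aⱼ`. -/
noncomputable def coef (n : ℕ) (a : Fin n → I) : ⋀[R]^n M →ₗ[R] R :=
  pairingDual R M n (ιMulti R n fun i => b.coord (a i))

theorem coef_ιMulti (n : ℕ) (a : Fin n → I) (v : Fin n → M) :
    coef b n a (ιMulti R n v) = (Matrix.of fun i j => b.repr (v i) (a j)).det := by
  simp [coef]

theorem eq_zero_of_coef_eq_zero {n : ℕ} {ω : ⋀[R]^n M} (h : ∀ a, coef b n a ω = 0) : ω = 0 := by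
  classical
  let _ : LinearOrder I := linearOrderOfSTO WellOrderingRel
  refine (b.exteriorPower n).ext_elem fun s => ?_
  rw [basis_repr_apply, map_zero, Finsupp.zero_apply]
  exact h _

theorem span_ιMulti_basis (n : ℕ) :
    Submodule.span R (Set.range fun a : Fin n → I => ιMulti R n (fun i => b (a i))) = ⊤ := by
  rw [← ιMulti_span_of_span R n M b.span_eq]
  congr 1
  ext x
  constructor
  · rintro ⟨a, rfl⟩
    exact ⟨_, by rintro _ ⟨i, rfl⟩; exact ⟨_, rfl⟩, rfl⟩
  · rintro ⟨v, hv, rfl⟩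
    choose a ha using fun i => hv ⟨i, rfl⟩
    exact ⟨a, by simp [ha]⟩

theorem finite_coef_ne_zero {n : ℕ} (ω : ⋀[R]^n M) : {a | coef b n a ω ≠ 0}.Finite := by
  have hω : ω ∈ Submodule.span R (Set.range fun a : Fin n → I => ιMulti R n (fun i => b (a i))) :=
    span_ιMulti_basis b n ▸ Submodule.mem_top
  induction hω using Submodule.span_induction with
  | zero => simp
  | add u v _ _ hu hv =>
    refine (hu.union hv).subset fun a ha => ?_
    by_contra hc
    simp only [Set.mem_union, Set.mem_ofPred_eq, not_or, not_not] at hc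
    exact ha (by rw [map_add, hc.1, hc.2, add_zero])
  | smul c u _ hu =>
    refine hu.subset fun a ha hc => ha ?_
    rw [map_smul, hc, smul_zero]
  | mem u hu =>
    obtain ⟨v, rfl⟩ := hu
    refine (Set.Finite.pi' (t := fun _ : Fin n => Set.range v)
      fun _ => Set.finite_range v).subset fun a ha j => ?_
    by_contra hj
    refine ha ?_
    rw [coef_ιMulti]
    refine Matrix.det_eq_zero_of_column_eq_zero j fun i => ?_
    rw [Matrix.of_apply, b.repr_self, Finsupp.single_eq_of_ne]
    exact fun h => hj ⟨i, h.symm⟩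

/-- Both sides are the derivative of the determinant at `A` in the direction `B`, namely the trace
of `adjugate A * B`. -/
theorem _root_.Matrix.sum_det_updateRow_eq_sum_det_updateCol {n : Type*} [Fintype n] [DecidableEq n]
    (A B : Matrix n n R) :
    ∑ i, (A.updateRow i (B i)).det = ∑ j, (A.updateCol j fun i => B i j).det := by
  simp only [← Matrix.cramer_transpose_apply, ← Matrix.cramer_apply,
    Matrix.cramer_eq_adjugate_mulVec, Matrix.mulVec, dotProduct, ← Matrix.adjugate_transpose,
    Matrix.transpose_apply]
  exact Finset.sum_comm

/-- A derivation modifies one vector at a time, a row of the coordinate matrix. The preceding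
determinant identity trades this for modifying one index at a time, a column, where the monomial
form of the transpose of `f` applies. -/
theorem coef_deriv {n : ℕ} (f : Module.End R M) (κ : I → R) (π : I → I)
    (hf : ∀ a x, b.repr (f x) a = κ a * b.repr x (π a)) (a : Fin n → I) (ω : ⋀[R]^n M) :
    coef b n a (ExtPowLie.deriv R n f ω) =
      ∑ k, κ (a k) * coef b n (Function.update a k (π (a k))) ω := by
  have h : coef b n a ∘ₗ ExtPowLie.deriv R n f =
      ∑ k, κ (a k) • coef b n (Function.update a k (π (a k))) := by
    refine linearMap_ext (AlternatingMap.ext fun v => ?_)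
    simp only [LinearMap.compAlternatingMap_apply, LinearMap.comp_apply, LinearMap.sum_apply,
      LinearMap.smul_apply, ExtPowLie.deriv_ιMulti, map_sum, coef_ιMulti]
    refine Eq.trans (Finset.sum_congr rfl fun i _ => ?_)
      ((Matrix.sum_det_updateRow_eq_sum_det_updateCol
        (Matrix.of fun i j => b.repr (v i) (a j)) (Matrix.of fun i j => b.repr (f (v i)) (a j))).trans
        (Finset.sum_congr rfl fun j _ => ?_))
    · congr 1
      ext k j
      rcases eq_or_ne k i with rfl | hk
      · simp
      · simp [hk]
    · rw [smul_eq_mul, show (Matrix.of fun i l => b.repr (v i) (Function.update a j (π (a j)) l)) =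
        (Matrix.of fun i l => b.repr (v i) (a l)).updateCol j fun i => b.repr (v i) (π (a j)) from ?_,
        ← Matrix.det_updateCol_smul]
      · congr 2
        ext i
        simp [hf]
      · ext i l
        rcases eq_or_ne l j with rfl | hl
        · simp
        · simp [hl]
  simpa using LinearMap.congr_fun h ω

end exteriorPower

/-! ### The two Witt algebras acting on the generators -/

namespace BMS4

/-- The generators `l_m` (for `s = true`) and `l̄_m` (for `s = false`) of the two Witt algebras. -/
def Gen.witt : Bool → ℤ → Gen
  | true, m => .l m
  | false, m => .lbar m

/-- Up to a scalar, `l_m` (for `s = true`) or `l̄_m` (for `s = false`) maps the generator `a` to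
`shift s m a`. -/
def Gen.shift : Bool → ℤ → Gen → Gen
  | true, m, .l i => .l (i + m)
  | true, _, .lbar i => .lbar i
  | true, m, .T p q => .T (p + m) q
  | false, _, .l i => .l i
  | false, m, .lbar i => .lbar (i + m)
  | false, m, .T p q => .T p (q + m)

/-- The index of a generator which is shifted by the Witt algebra `s`. -/
def Gen.idx : Bool → Gen → ℤ
  | true, .l i => i
  | true, .lbar _ => 0
  | true, .T p _ => p
  | false, .l _ => 0
  | false, .lbar i => i
  | false, .T _ q => q

/-- The generator does not commute with the Witt algebra `s`. -/
def Gen.Moved : Bool → Gen → Prop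
  | true, .lbar _ => False
  | false, .l _ => False
  | _, _ => True

/-- The coefficient of the action of a Witt algebra on a generator. -/
noncomputable def weight (𝕜 : Type*) [Field 𝕜] : Bool → ℤ → Gen → 𝕜
  | true, m, .l i => m - i
  | true, _, .lbar _ => 0
  | true, m, .T p _ => ((m : 𝕜) + 1) / 2 - p
  | false, _, .l _ => 0
  | false, m, .lbar i => m - i
  | false, m, .T _ q => ((m : 𝕜) + 1) / 2 - q

open Gen

theorem Gen.shift_add (s : Bool) (m n : ℤ) (a : Gen) :
    shift s m (shift s n a) = shift s (n + m) a := by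
  cases s <;> cases a <;> simp [shift, add_assoc]

@[simp]
theorem Gen.shift_zero (s : Bool) (a : Gen) : shift s 0 a = a := by
  cases s <;> cases a <;> simp [shift]

@[simp]
theorem Gen.shift_neg_shift (s : Bool) (m : ℤ) (a : Gen) : shift s (-m) (shift s m a) = a := by
  simp [shift_add]

@[simp]
theorem Gen.shift_shift_neg (s : Bool) (m : ℤ) (a : Gen) : shift s m (shift s (-m) a) = a := by
  simp [shift_add]

theorem Gen.shift_comm (s t : Bool) (m n : ℤ) (a : Gen) :
    shift s m (shift t n a) = shift t n (shift s m a) := by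
  cases s <;> cases t <;> cases a <;> simp [shift, add_right_comm]

@[simp]
theorem Gen.moved_shift (s t : Bool) (m : ℤ) (a : Gen) : Moved s (shift t m a) ↔ Moved s a := by
  cases s <;> cases t <;> cases a <;> simp [shift, Moved]

theorem Gen.idx_shift {s : Bool} {a : Gen} (ha : Moved s a) (m : ℤ) :
    idx s (shift s m a) = idx s a + m := by
  cases s <;> cases a <;> simp_all [shift, Moved, idx]

@[simp]
theorem Gen.idx_shift_not (s : Bool) (m : ℤ) (a : Gen) : idx (!s) (shift s m a) = idx (!s) a := by
  cases s <;> cases a <;> simp [shift, idx]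

theorem Gen.exists_moved (a : Gen) : ∃ s, Moved s a := by
  cases a
  · exact ⟨true, trivial⟩
  · exact ⟨false, trivial⟩
  · exact ⟨true, trivial⟩

variable (𝕜 : Type*) [Field 𝕜]

@[simp]
theorem weight_shift_not (s : Bool) (m n : ℤ) (a : Gen) :
    weight 𝕜 (!s) m (shift s n a) = weight 𝕜 (!s) m a := by
  cases s <;> cases a <;> simp [shift, weight]

theorem weight_of_not_moved {s : Bool} {a : Gen} (ha : ¬Moved s a) (m : ℤ) :
    weight 𝕜 s m a = 0 := by
  cases s <;> cases a <;> simp_all [Moved, weight]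

/-- The element `l_m` (for `s = true`) or `l̄_m` (for `s = false`). -/
noncomputable def witt (s : Bool) (m : ℤ) : BMS4 𝕜 := basis 𝕜 (Gen.witt s m)

variable [CharZero 𝕜]

/-- With index `i`, the weight vanishes only at `m = i` (Witt generators) or `m = 2i - 1`
(supertranslations), and both are at most `2|i|`. -/
theorem weight_ne_zero {s : Bool} {a : Gen} (ha : Moved s a) {m : ℤ} (hm : 2 * |idx s a| < m) :
    weight 𝕜 s m a ≠ 0 := by
  have key : ∀ i : ℤ, 2 * |i| < m → (m : 𝕜) - i ≠ 0 ∧ ((m : 𝕜) + 1) / 2 - i ≠ 0 := by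
    intro i hi
    have h1 := abs_lt.1 (show |i| < m by linarith [abs_nonneg i])
    have h2 := le_abs_self i
    refine ⟨fun h => ?_, fun h => ?_⟩
    · have : m - i = 0 := by exact_mod_cast h
      omega
    · have h' : (m : 𝕜) + 1 - 2 * i = 0 := by linear_combination 2 * h
      have : m + 1 - 2 * i = 0 := by exact_mod_cast h'
      omega
  cases s <;> cases a <;> simp_all [Moved, weight, idx]

theorem lie_witt_basis (s : Bool) (m : ℤ) (a : Gen) :
    ⁅witt 𝕜 s m, basis 𝕜 a⁆ = weight 𝕜 s m a • basis 𝕜 (shift s m a) := by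
  refine (bracketBilin_basis 𝕜 _ _).trans ?_
  cases s <;> cases a <;> simp [genBracket, Gen.witt, weight, shift, l, lbar, T, add_comm]

theorem lie_witt_witt (s : Bool) (m n : ℤ) :
    ⁅witt 𝕜 s m, witt 𝕜 s n⁆ = ((m : 𝕜) - n) • witt 𝕜 s (m + n) := by
  refine (lie_witt_basis 𝕜 s m _).trans ?_
  cases s <;> simp [Gen.witt, weight, shift, witt, add_comm]

theorem lie_witt_witt_not (s : Bool) (m n : ℤ) : ⁅witt 𝕜 s m, witt 𝕜 (!s) n⁆ = 0 := by
  refine (lie_witt_basis 𝕜 s m _).trans ?_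
  cases s <;> simp [Gen.witt, weight]

variable {𝕜}

theorem repr_lie_witt (s : Bool) (m : ℤ) (a : Gen) (x : BMS4 𝕜) :
    (basis 𝕜).repr ⁅witt 𝕜 s m, x⁆ a =
      weight 𝕜 s m (shift s (-m) a) * (basis 𝕜).repr x (shift s (-m) a) := by
  have h : (basis 𝕜).coord a ∘ₗ (LieModule.toEnd 𝕜 (BMS4 𝕜) (BMS4 𝕜) (witt 𝕜 s m)) =
      weight 𝕜 s m (shift s (-m) a) • (basis 𝕜).coord (shift s (-m) a) := by
    refine (basis 𝕜).ext fun c => ?_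
    by_cases hc : shift s m c = a
    · subst hc
      simp [lie_witt_basis]
    · have hc' : shift s (-m) a ≠ c := fun h => hc (by rw [← h, shift_shift_neg])
      simp [lie_witt_basis, hc, hc'.symm]
  exact LinearMap.congr_fun h x

/-! ### Invariants -/

theorem exists_idx_bound {ι : Type*} {S : Set (ι → Gen)} [Finite ι] (hS : S.Finite) (s : Bool) :
    ∃ K : ℤ, 0 ≤ K ∧ ∀ a ∈ S, ∀ k, |idx s (a k)| ≤ K := by
  have hfin : (⋃ k : ι, (fun a => |idx s (a k)|) '' S).Finite :=
    Set.finite_iUnion fun k => hS.image _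
  obtain ⟨K, hK⟩ := hfin.bddAbove
  refine ⟨max K 0, le_max_right _ _, fun a ha k => le_max_of_le_left (hK ?_)⟩
  exact Set.mem_iUnion.2 ⟨k, a, ha, rfl⟩

/-- A finitely supported family of coordinates which is killed by a Witt algebra vanishes wherever
one of the indices is moved by this algebra. -/
theorem eq_zero_of_killed {n : ℕ} {F : (Fin n → Gen) → 𝕜} (hF : {a | F a ≠ 0}.Finite) {s : Bool}
    {a : Fin n → Gen} {k : Fin n} (hk : Moved s (a k))
    (h : ∀ m, ∑ j, weight 𝕜 s m (shift s (-m) (Function.update a k (shift s m (a k)) j)) *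
      F (Function.update (Function.update a k (shift s m (a k))) j
        (shift s (-m) (Function.update a k (shift s m (a k)) j))) = 0) : F a = 0 := by
  obtain ⟨K, hK0, hK⟩ := exists_idx_bound hF s
  by_contra hne
  have hak := hK a hne k
  -- Indices in the support lie in `[-K, K]`, so a shift by `2K + 1` leaves the support and the
  -- weight is nonzero. Only the term undoing the shift in slot `k` survives.
  have hm := h (2 * K + 1)
  rw [Finset.sum_eq_single k] at hm
  · simp only [Function.update_self, shift_neg_shift, Function.update_idem,
      Function.update_eq_self] at hm
    exact (mul_ne_zero (weight_ne_zero 𝕜 hk (by omega)) hne) hm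
  · intro j _ hj
    refine mul_eq_zero_of_right _ ?_
    by_contra hj0
    have := hK _ hj0 k
    rw [Function.update_of_ne hj.symm, Function.update_self, idx_shift hk] at this
    have h1 := abs_le.1 this
    have h2 := abs_le.1 hak
    omega
  · simp

/-- Positive degree supplies a slot to shift, and every generator is moved by at least one of the
two Witt algebras. -/
theorem eq_zero_of_invariant {n : ℕ} {F : (Fin (n + 1) → Gen) → 𝕜} (hF : {a | F a ≠ 0}.Finite)
    (h : ∀ s m a, ∑ j, weight 𝕜 s m (shift s (-m) (a j)) *
      F (Function.update a j (shift s (-m) (a j))) = 0) (a : Fin (n + 1) → Gen) : F a = 0 := by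
  obtain ⟨s, hs⟩ := exists_moved (a 0)
  exact eq_zero_of_killed hF hs fun m => h s m _

theorem coef_lie_witt {n : ℕ} (s : Bool) (m : ℤ) (a : Fin n → Gen) (ω : ⋀[𝕜]^n (BMS4 𝕜)) :
    exteriorPower.coef (basis 𝕜) n a ⁅witt 𝕜 s m, ω⁆ =
      ∑ j, weight 𝕜 s m (shift s (-m) (a j)) *
        exteriorPower.coef (basis 𝕜) n (Function.update a j (shift s (-m) (a j))) ω :=
  exteriorPower.coef_deriv (basis 𝕜) _ (fun a => weight 𝕜 s m (shift s (-m) a)) (shift s (-m))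
    (fun a x => repr_lie_witt s m a x) a ω

theorem exteriorPower_eq_zero_of_invariant {n : ℕ} {ω : ⋀[𝕜]^(n + 1) (BMS4 𝕜)}
    (h : ∀ s m, ⁅witt 𝕜 s m, ω⁆ = 0) : ω = 0 := by
  refine exteriorPower.eq_zero_of_coef_eq_zero (basis 𝕜) fun a => ?_
  refine eq_zero_of_invariant (F := fun a => exteriorPower.coef (basis 𝕜) (n + 1) a ω)
    (exteriorPower.finite_coef_ne_zero _ ω) (fun s m a => ?_) a
  rw [← coef_lie_witt, h, map_zero]

/-- The Schouten bracket is defined as a tensor, so triangularity needs this version instead of the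
one for `⋀³`. The support argument never uses skewness. -/
theorem tensorCube_eq_zero_of_invariant {ω : (BMS4 𝕜 ⊗[𝕜] BMS4 𝕜) ⊗[𝕜] BMS4 𝕜}
    (h : ∀ s m, ⁅witt 𝕜 s m, ω⁆ = 0) : ω = 0 := by
  set B := ((basis 𝕜).tensorProduct (basis 𝕜)).tensorProduct (basis 𝕜)
  have key : ∀ a : Fin 3 → Gen, B.repr ω ((a 0, a 1), a 2) = 0 := by
    refine eq_zero_of_invariant ?_ fun s m a => ?_
    · refine (Set.Finite.preimage (f := fun a : Fin 3 → Gen => ((a 0, a 1), a 2)) ?_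
        (B.repr ω).hasFiniteSupport).subset fun a ha => by simpa using ha
      intro a _ a' _ haa
      simp only [Prod.mk.injEq] at haa
      ext i
      fin_cases i <;> simp [haa]
    · have : ∀ ω, B.repr ⁅witt 𝕜 s m, ω⁆ ((a 0, a 1), a 2) =
          ∑ j : Fin 3, weight 𝕜 s m (shift s (-m) (a j)) *
          B.repr ω ((Function.update a j (shift s (-m) (a j)) 0,
            Function.update a j (shift s (-m) (a j)) 1),
            Function.update a j (shift s (-m) (a j)) 2) := by
        intro ω
        induction ω using TensorProduct.induction_on with
        | zero => simp
        | add u v hu hv =>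
          rw [lie_add, map_add, Finsupp.add_apply, hu, hv, ← Finset.sum_add_distrib]
          simp [mul_add]
        | tmul u z =>
          induction u using TensorProduct.induction_on with
          | zero => simp
          | add u v hu hv =>
            rw [TensorProduct.add_tmul, lie_add, map_add, Finsupp.add_apply, hu, hv,
              ← Finset.sum_add_distrib]
            simp [mul_add]
          | tmul x y =>
            simp only [TensorProduct.LieModule.lie_tmul_right, TensorProduct.add_tmul, map_add,
              Finsupp.add_apply, B, Module.Basis.tensorProduct_repr_tmul_apply, repr_lie_witt,
              Fin.sum_univ_three, smul_eq_mul]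
            simp
            ring
      rw [← this, h]
      simp
  refine B.ext_elem fun i => ?_
  simpa using key ![i.1.1, i.1.2, i.2]

end BMS4

/-! ### Coboundary Lie bialgebras -/

namespace LieBialg

variable {R L : Type*} [CommRing R] [LieRing L] [LieAlgebra R L]

theorem cobracketOf_apply (r : ⋀[R]^2 L) (x : L) : cobracketOf r x = ⁅x, r⁆ := rfl

theorem cobracketOf_add (r s : ⋀[R]^2 L) : cobracketOf (r + s) = cobracketOf r + cobracketOf s :=
  map_add _ r s

theorem cobracketOf_smul (c : R) (r : ⋀[R]^2 L) : cobracketOf (c • r) = c • cobracketOf r :=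
  map_smul _ c r

theorem cobracketOf_zero : cobracketOf (0 : ⋀[R]^2 L) = 0 :=
  map_zero (LieH1.d₀₁ R L (⋀[R]^2 L))

theorem cobracketOf_cocycle (r : ⋀[R]^2 L) (x y : L) :
    cobracketOf r ⁅x, y⁆ = ⁅x, cobracketOf r y⁆ - ⁅y, cobracketOf r x⁆ := by
  simp [cobracketOf_apply, lie_lie]

theorem lie_smul_bivector (x : L) (c : R) (r : ⋀[R]^2 L) : ⁅x, c • r⁆ = c • ⁅x, r⁆ :=
  LieModule.lie_smul c x r

theorem lie_smul_tensorCube (x : L) (c : R) (t : (L ⊗[R] L) ⊗[R] L) : ⁅x, c • t⁆ = c • ⁅x, t⁆ :=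
  LieModule.lie_smul c x t

theorem lie_wedge (x a b : L) : ⁅x, exteriorPower.ιMulti R 2 ![a, b]⁆ =
    exteriorPower.ιMulti R 2 ![⁅x, a⁆, b] + exteriorPower.ιMulti R 2 ![a, ⁅x, b⁆] := by
  rw [ExtPowLie.lie_ιMulti, Fin.sum_univ_two]
  congr 2 <;> (ext i; fin_cases i <;> simp)

theorem toTensor_wedge (a b : L) :
    toTensor R L (exteriorPower.ιMulti R 2 ![a, b]) = a ⊗ₜ[R] b - b ⊗ₜ[R] a :=
  toTensor_ιMulti R L _

theorem bivector_induction {P : ⋀[R]^2 L → Prop} (wedge : ∀ a b, P (exteriorPower.ιMulti R 2 ![a, b]))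
    (zero : P 0) (add : ∀ r s, P r → P s → P (r + s)) (smul : ∀ (c : R) r, P r → P (c • r))
    (r : ⋀[R]^2 L) : P r := by
  have hr : r ∈ Submodule.span R (Set.range (exteriorPower.ιMulti R 2 (M := L))) :=
    exteriorPower.ιMulti_span R 2 L ▸ Submodule.mem_top
  induction hr using Submodule.span_induction with
  | mem u hu =>
    obtain ⟨v, rfl⟩ := hu
    have : v = ![v 0, v 1] := by ext i; fin_cases i <;> rfl
    rw [this]
    exact wedge _ _
  | zero => exact zero
  | add u v _ _ hu hv => exact add u v hu hv
  | smul c u _ hu => exact smul c u hu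

/-- The sum of the three brackets in the Schouten bracket, before polarization. -/
noncomputable def schoutenForm (r s : ⋀[R]^2 L) : (L ⊗[R] L) ⊗[R] L :=
  (br1213 R L + br1223 R L + br1323 R L) (toTensor R L r ⊗ₜ[R] toTensor R L s)

/-- The co-Jacobi expression for two different coboundary cobrackets. -/
noncomputable def coJacobiForm (x : L) (r s : ⋀[R]^2 L) : (L ⊗[R] L) ⊗[R] L :=
  cycl R L ((toTensor R L ∘ₗ cobracketOf r).rTensor L (toTensor R L ⁅x, s⁆))

theorem coJacobiForm_wedge (x a b c d : L) :
    coJacobiForm x (exteriorPower.ιMulti R 2 ![a, b]) (exteriorPower.ιMulti R 2 ![c, d]) +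
      coJacobiForm x (exteriorPower.ιMulti R 2 ![c, d]) (exteriorPower.ιMulti R 2 ![a, b]) =
    -⁅x, schoutenForm (exteriorPower.ιMulti R 2 ![a, b]) (exteriorPower.ιMulti R 2 ![c, d]) +
      schoutenForm (exteriorPower.ιMulti R 2 ![c, d]) (exteriorPower.ιMulti R 2 ![a, b])⁆ := by
  simp only [coJacobiForm, schoutenForm, lie_wedge, map_add, map_sub, toTensor_wedge,
    LinearMap.rTensor_tmul, LinearMap.comp_apply, cobracketOf_apply, cycl, LinearMap.add_apply,
    LinearMap.id_apply, TensorProduct.add_tmul, TensorProduct.sub_tmul,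
    TensorProduct.tmul_sub, rot_tmul, br1213_tmul, br1223_tmul, br1323_tmul, lie_add, lie_sub,
    TensorProduct.LieModule.lie_tmul_right]
  -- After the Leibniz rule for `x`, the next lines orient every bracket the same way, so that the
  -- remaining identity is one in an additive group.
  simp only [leibniz_lie x]
  rw [← lie_skew c a, ← lie_skew c b, ← lie_skew d a, ← lie_skew d b]
  simp only [← lie_skew a ⁅x, c⁆, ← lie_skew a ⁅x, d⁆, ← lie_skew b ⁅x, c⁆, ← lie_skew b ⁅x, d⁆,
    ← lie_skew c ⁅x, a⁆, ← lie_skew c ⁅x, b⁆, ← lie_skew d ⁅x, a⁆, ← lie_skew d ⁅x, b⁆,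
    TensorProduct.neg_tmul, TensorProduct.tmul_neg, TensorProduct.add_tmul, TensorProduct.tmul_add]
  abel

/-- Drinfeld's identity is quadratic in `r`, so it cannot be checked on decomposable bivectors
alone. Its symmetric polarization is bilinear and can; setting `s = r` and dividing by 2 recovers
it. -/
theorem coJacobiForm_add_swap (x : L) (r s : ⋀[R]^2 L) :
    coJacobiForm x r s + coJacobiForm x s r = -⁅x, schoutenForm r s + schoutenForm s r⁆ := by
  induction r using bivector_induction with
  | zero => simp [coJacobiForm, schoutenForm, cobracketOf_zero]
  | add r r' hr hr' =>
    refine Eq.trans ?_ ((congrArg₂ (· + ·) hr hr').trans ?_)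
    · simp only [coJacobiForm, cobracketOf_add, LinearMap.comp_add, LinearMap.rTensor_add,
        LinearMap.add_apply, map_add, lie_add]
      abel
    · simp only [schoutenForm, map_add, TensorProduct.add_tmul, TensorProduct.tmul_add, lie_add]
      abel
  | smul c r hr =>
    refine Eq.trans ?_ ((congrArg (c • ·) hr).trans ?_)
    · simp only [coJacobiForm, cobracketOf_smul, LinearMap.comp_smul, LinearMap.rTensor_smul,
        LinearMap.smul_apply, map_smul, lie_smul_bivector, smul_add]
    · simp only [schoutenForm, map_smul, ← TensorProduct.smul_tmul', TensorProduct.tmul_smul,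
        lie_smul_tensorCube, smul_add, smul_neg, lie_add]
  | wedge a b =>
    induction s using bivector_induction with
    | zero => simp [coJacobiForm, schoutenForm, cobracketOf_zero]
    | add r r' hr hr' =>
      refine Eq.trans ?_ ((congrArg₂ (· + ·) hr hr').trans ?_)
      · simp only [coJacobiForm, cobracketOf_add, LinearMap.comp_add, LinearMap.rTensor_add,
          LinearMap.add_apply, map_add, lie_add]
        abel
      · simp only [schoutenForm, map_add, TensorProduct.add_tmul, TensorProduct.tmul_add, lie_add]
        abel
    | smul c r hr =>
      refine Eq.trans ?_ ((congrArg (c • ·) hr).trans ?_)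
      · simp only [coJacobiForm, cobracketOf_smul, LinearMap.comp_smul, LinearMap.rTensor_smul,
          LinearMap.smul_apply, map_smul, lie_smul_bivector, smul_add]
      · simp only [schoutenForm, map_smul, ← TensorProduct.smul_tmul', TensorProduct.tmul_smul,
          lie_smul_tensorCube, smul_add, smul_neg, lie_add]
    | wedge c d => exact coJacobiForm_wedge x a b c d

/-- Drinfeld's identity: the co-Jacobi expression of `δ_r` at `x` is `-x · [[r, r]]`. -/
theorem cycl_cobracketOf {𝕜 : Type*} [Field 𝕜] [CharZero 𝕜] [LieAlgebra 𝕜 L] (r : ⋀[𝕜]^2 L)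
    (x : L) : cycl 𝕜 L ((toTensor 𝕜 L ∘ₗ cobracketOf r).rTensor L
      (toTensor 𝕜 L (cobracketOf r x))) = -⁅x, schouten r⁆ := by
  have h := coJacobiForm_add_swap x r r
  rw [lie_add, neg_add, ← two_smul 𝕜, ← two_smul 𝕜 (-_)] at h
  exact smul_right_injective _ (two_ne_zero (α := 𝕜)) h

theorem map_lie_bivector (φ : L ≃ₗ⁅R⁆ L) (x : L) (r : ⋀[R]^2 L) :
    exteriorPower.map 2 (φ : L →ₗ[R] L) ⁅x, r⁆ =
      ⁅φ x, exteriorPower.map 2 (φ : L →ₗ[R] L) r⁆ := by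
  induction r using bivector_induction with
  | zero => simp
  | add r s hr hs => simp [hr, hs]
  | smul c r hr => simp only [lie_smul_bivector, map_smul, hr]
  | wedge a b =>
    rw [lie_wedge, map_add]
    simp only [exteriorPower.map_apply_ιMulti]
    have h : ∀ a b : L, ((φ : L →ₗ[R] L) ∘ ![a, b]) = ![φ a, φ b] := fun a b => by
      ext i; fin_cases i <;> rfl
    rw [h, h, h, lie_wedge, LieEquiv.map_lie, LieEquiv.map_lie]

theorem isomorphic_cobracketOf_iff (hinv : ∀ ω : ⋀[R]^2 L, (∀ x : L, ⁅x, ω⁆ = 0) → ω = 0)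
    (r₁ r₂ : ⋀[R]^2 L) : Isomorphic (cobracketOf r₁) (cobracketOf r₂) ↔
      ∃ φ : L ≃ₗ⁅R⁆ L, exteriorPower.map 2 (φ : L →ₗ[R] L) r₁ = r₂ := by
  refine exists_congr fun φ => ⟨fun h => sub_eq_zero.1 (hinv _ fun y => ?_), ?_⟩
  · obtain ⟨x, rfl⟩ := φ.surjective y
    have hx := h x
    rw [cobracketOf_apply, cobracketOf_apply, map_lie_bivector] at hx
    rw [lie_sub, sub_eq_zero]
    exact hx
  · rintro rfl x
    exact map_lie_bivector φ x r₁

end LieBialg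

/-! ### The cohomology of the Witt algebra in its second exterior power -/

/-- A property of integers which holds at `±1`, `±2` and is stable under sums of distinct integers
holds everywhere: the Witt algebra is generated by `l_{±1}`, `l_{±2}`. -/
theorem Int.induction_of_witt_generators {P : ℤ → Prop} (h1 : P 1) (h2 : P 2) (h1' : P (-1))
    (h2' : P (-2)) (hadd : ∀ m n, P m → P n → m ≠ n → P (m + n)) (m : ℤ) : P m := by
  have hpos : ∀ k : ℕ, P (k + 1) := by
    intro k
    induction k with
    | zero => simpa using h1
    | succ k ih =>
      rcases Nat.eq_zero_or_pos k with rfl | hk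
      · simpa using h2
      · simpa using hadd _ _ ih h1 (by omega)
  have hneg : ∀ k : ℕ, P (-(k + 1)) := by
    intro k
    induction k with
    | zero => simpa using h1'
    | succ k ih =>
      rcases Nat.eq_zero_or_pos k with rfl | hk
      · simpa using h2'
      · have := hadd _ _ ih h1' (by omega)
        convert this using 1
        push_cast
        ring
  rcases lt_trichotomy m 0 with hm | rfl | hm
  · have := hneg (-m - 1).toNat
    rwa [show -(((-m - 1).toNat : ℤ) + 1) = m by omega] at this
  · exact hadd 1 (-1) h1 h1' (by norm_num)
  · have := hpos (m - 1).toNat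
    rwa [show ((m - 1).toNat : ℤ) + 1 = m by omega] at this

theorem Int.forall_ge_of_descend {P : ℤ → Prop} {N K : ℤ} (hK : ∀ i, K ≤ i → P i)
    (h : ∀ i, N ≤ i → P (i + 1) → P i) (i : ℤ) (hi : N ≤ i) : P i := by
  have key : ∀ k : ℕ, ∀ i, N ≤ i → K ≤ i + k → P i := by
    intro k
    induction k with
    | zero => intro i _ hk; exact hK i (by simpa using hk)
    | succ k ih => intro i hi hk; exact h i hi (ih (i + 1) (by omega) (by push_cast at hk; omega))
  exact key (K - i).toNat i hi (by omega)

/-- Solving downwards from infinity, starting with zeros beyond `K`, keeps the solution finitely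
supported. -/
theorem exists_descending_recursion {𝕜 : Type*} [Semiring 𝕜] (K : ℕ) (f u : ℕ → 𝕜)
    (hf : ∀ k, K ≤ k → f k = 0) :
    ∃ r : ℕ → 𝕜, (∀ k, K ≤ k → r k = 0) ∧ ∀ k, r k = f k + u k * r (k + 1) := by
  induction K generalizing f u with
  | zero => exact ⟨0, fun _ _ => rfl, fun k => by simp [hf k]⟩
  | succ K ih =>
    obtain ⟨r, hr0, hr⟩ := ih (fun k => f (k + 1)) (fun k => u (k + 1)) fun k hk => hf _ (by omega)
    refine ⟨fun k => k.casesOn (f 0 + u 0 * r 0) r, fun k hk => ?_, fun k => ?_⟩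
    · cases k with
      | zero => omega
      | succ k => exact hr0 k (by omega)
    · cases k with
      | zero => rfl
      | succ k => exact hr k

namespace Witt

variable {𝕜 : Type*} [Field 𝕜]

/-- The action of `l_m` on the coordinates, with respect to the `l_i ⊗ l_j`, of a 2-tensor over the
Witt algebra. -/
def act (m : ℤ) (F : ℤ → ℤ → 𝕜) (i j : ℤ) : 𝕜 :=
  (2 * m - i) * F (i - m) j + (2 * m - j) * F i (j - m)

/-- The coordinates of a bivector. -/
structure IsBivector (F : ℤ → ℤ → 𝕜) : Prop where
  skew : ∀ i j, F j i = -F i j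
  bdd : ∃ K : ℤ, ∀ i j, F i j ≠ 0 → |i| ≤ K ∧ |j| ≤ K

/-- A 1-cocycle of the Witt algebra with values in bivectors, in coordinates. -/
structure IsCocycle (c : ℤ → ℤ → ℤ → 𝕜) : Prop where
  isBivector : ∀ m, IsBivector (c m)
  cocycle : ∀ m n i j : ℤ, ((m : 𝕜) - n) * c (m + n) i j = act m (c n) i j - act n (c m) i j

theorem IsBivector.map_act {F : ℤ → ℤ → 𝕜} (hF : IsBivector F) (m : ℤ) : IsBivector (act m F) := by
  obtain ⟨hs, K, hK⟩ := hF
  refine ⟨fun i j => ?_, K + |m|, fun i j h => ?_⟩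
  · rw [act, act, hs i (j - m), hs (i - m) j]
    ring
  · by_contra hc
    have aux : ∀ i j, F i j ≠ 0 → (|i| ≤ K ∧ |j| ≤ K) := hK
    have h1 : F (i - m) j = 0 := by
      by_contra h0
      have := aux _ _ h0
      have := abs_add_le (i - m) m
      rw [sub_add_cancel] at this
      exact hc ⟨by omega, by have := abs_nonneg m; omega⟩
    have h2 : F i (j - m) = 0 := by
      by_contra h0
      have := aux _ _ h0
      have := abs_add_le (j - m) m
      rw [sub_add_cancel] at this
      exact hc ⟨by have := abs_nonneg m; omega, by omega⟩
    exact h (by rw [act, h1, h2]; ring)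

theorem IsBivector.sub {F G : ℤ → ℤ → 𝕜} (hF : IsBivector F) (hG : IsBivector G) :
    IsBivector fun i j => F i j - G i j := by
  obtain ⟨hs, K, hK⟩ := hF
  obtain ⟨hs', K', hK'⟩ := hG
  refine ⟨fun i j => by rw [hs, hs']; ring, max K K', fun i j h => ?_⟩
  by_cases h0 : F i j = 0
  · have := hK' i j fun h1 => h (by rw [h0, h1, sub_zero])
    omega
  · have := hK i j h0
    omega

theorem IsBivector.add {F G : ℤ → ℤ → 𝕜} (hF : IsBivector F) (hG : IsBivector G) :
    IsBivector fun i j => F i j + G i j := by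
  have h0 : IsBivector (fun _ _ => 0 : ℤ → ℤ → 𝕜) := ⟨by simp, 0, by simp⟩
  simpa using hF.sub (h0.sub hG)

theorem act_add (m : ℤ) (F G : ℤ → ℤ → 𝕜) (i j : ℤ) :
    act m (fun i j => F i j + G i j) i j = act m F i j + act m G i j := by
  simp only [act]; ring

theorem IsCocycle.sub_act {c : ℤ → ℤ → ℤ → 𝕜} (hc : IsCocycle c) {r : ℤ → ℤ → 𝕜}
    (hr : IsBivector r) : IsCocycle fun m i j => c m i j - act m r i j := by
  refine ⟨fun m => (hc.isBivector m).sub (hr.map_act m), fun m n i j => ?_⟩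
  have h := hc.cocycle m n i j
  simp only [act] at h ⊢
  rw [mul_sub, h]
  simp only [show i - (m + n) = i - m - n by ring, show j - (m + n) = j - m - n by ring,
    show i - n - m = i - m - n by ring, show j - n - m = j - m - n by ring]
  push_cast
  ring

theorem act_eq_zero_imp [CharZero 𝕜] {F : ℤ → ℤ → 𝕜} (hF : IsBivector F)
    (h : ∀ m i j, act m F i j = 0) (i j : ℤ) : F i j = 0 := by
  obtain ⟨_, K, hK⟩ := hF
  by_contra h0
  obtain ⟨hi, hj⟩ := hK i j h0
  have hi' := abs_le.1 hi
  have h1 := h (2 * K + 1) (i + (2 * K + 1)) j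
  have h2 : F (i + (2 * K + 1)) (j - (2 * K + 1)) = 0 := by
    by_contra h3
    have := abs_le.1 (hK _ _ h3).1
    omega
  rw [act, h2, mul_zero, add_zero, add_sub_cancel_right] at h1
  refine mul_ne_zero ?_ h0 h1
  have h3 : 2 * (2 * K + 1) - (i + (2 * K + 1)) ≠ 0 := by omega
  exact_mod_cast h3

variable [CharZero 𝕜]

/-- The usual weight reduction: `l_0` acts on the coordinate `(i, j)` by `-(i + j)`, so dividing by
this removes all parts of nonzero degree. -/
theorem IsCocycle.exists_homogeneous {c : ℤ → ℤ → ℤ → 𝕜} (hc : IsCocycle c) :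
    ∃ r, IsBivector r ∧ (∀ i j, c 0 i j - act 0 r i j = 0) ∧
      ∀ m i j, i + j ≠ m → c m i j - act m r i j = 0 := by
  -- On `i + j = 0` division by zero gives `0`; that part of `c 0` is treated separately below.
  have hr : IsBivector fun i j => -c 0 i j / ((i : 𝕜) + j) := by
    obtain ⟨hs, K, hK⟩ := hc.isBivector 0
    refine ⟨fun i j => ?_, K, fun i j h => hK i j fun h0 => h (by simp [h0])⟩
    rw [hs i j, add_comm (j : 𝕜), ← neg_div]
  refine ⟨_, hr, ?_⟩
  have hc' := hc.sub_act hr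
  generalize hd : (fun m i j => c m i j - act m (fun i j => -c 0 i j / ((i : 𝕜) + j)) i j) = d at hc'
  have hd' : ∀ m i j, c m i j - act m (fun i j => -c 0 i j / ((i : 𝕜) + j)) i j = d m i j :=
    fun m i j => by rw [← hd]
  simp only [hd']
  have h0 : ∀ i j : ℤ, i + j ≠ 0 → d 0 i j = 0 := by
    intro i j hij
    have hij' : (i : 𝕜) + j ≠ 0 := by exact_mod_cast hij
    rw [← hd', act, sub_zero, sub_zero]
    field_simp
    push_cast
    ring
  have hact : ∀ m i j, act m (d 0) i j = ((m : 𝕜) - i - j) * d m i j := by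
    intro m i j
    have := hc'.cocycle 0 m i j
    rw [zero_add, act] at this
    simp only [sub_zero] at this
    push_cast at this
    linear_combination this
  -- `d 0` lives on `i + j = 0`, so `act m (d 0)` lives on `i + j = m`, where the factor `m - i - j`
  -- vanishes. Hence `d 0` is invariant.
  have hz : ∀ i j, d 0 i j = 0 := by
    refine act_eq_zero_imp (hc'.isBivector 0) fun m i j => ?_
    by_cases hij : i + j = m
    · rw [hact, ← hij]
      push_cast
      ring
    · rw [act, h0 _ _ (by omega), h0 _ _ (by omega)]
      ring
  refine ⟨hz, fun m i j hij => ?_⟩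
  have h1 := hact m i j
  rw [act, hz, hz, mul_zero, mul_zero, add_zero] at h1
  refine (mul_eq_zero.1 h1.symm).resolve_left ?_
  have h3 : m - i - j ≠ 0 := by omega
  exact_mod_cast h3

/-- For `r = ∑ p_i l_i ∧ l_{-i}` over `i > 0`, the equation at `i` reads `(2 - i) p_{i-1} + (1 + i)
p_i = F i (1 - i)`, with `p_0 = 0`. The case `i = 1` fixes `p_1`, and `i ≥ 3` determines `p_2, p_3,
…` downwards. At `i = 2` the coefficient of `p_1` vanishes and no freedom is left, so that
coordinate is omitted. -/
theorem IsBivector.exists_act_one {F : ℤ → ℤ → 𝕜} (hF : IsBivector F) :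
    ∃ r, IsBivector r ∧ (∀ i j, i + j ≠ 0 → r i j = 0) ∧
      (∀ i, 3 ≤ i → F i (1 - i) = act 1 r i (1 - i)) ∧ F 1 0 = act 1 r 1 0 := by
  obtain ⟨hs, K, hK⟩ := hF
  obtain ⟨u, hu0, hu⟩ := exists_descending_recursion K.toNat
    (fun k => -F (k + 3) (-(k + 2)) / (k + 1)) (fun k => ((k : 𝕜) + 4) / (k + 1)) fun k hk => by
      rw [show F (k + 3) (-(k + 2)) = 0 from ?_, neg_zero, zero_div]
      by_contra h
      have := abs_le.1 (hK _ _ h).1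
      omega
  set p : ℤ → 𝕜 := fun i => if i = 1 then F 1 0 / 2 else if 2 ≤ i then u (i - 2).toNat else 0
    with hp
  have hp0 : ∀ i, i ≤ 0 → p i = 0 := by
    intro i hi
    simp only [hp]
    rw [if_neg (by omega), if_neg (by omega)]
  have hpK : ∀ i, p i ≠ 0 → |i| ≤ |K| + 2 := by
    intro i hi
    by_contra hc
    refine hi ?_
    rcases le_or_gt i 0 with h | h
    · exact hp0 i h
    · rw [abs_of_pos h] at hc
      have h1 := le_abs_self K
      have h2 := abs_nonneg K
      simp only [hp]
      rw [if_neg (by omega), if_pos (by omega), hu0]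
      omega
  refine ⟨fun i j => if i + j = 0 then p i - p j else 0, ⟨fun i j => ?_, |K| + 2, fun i j h => ?_⟩,
    fun i j h => if_neg h, fun i hi => ?_, ?_⟩
  · rw [add_comm j i]
    split_ifs <;> ring
  · by_cases hij : i + j = 0
    · rw [if_pos hij] at h
      have hji : j = -i := by omega
      have habs : |j| = |i| := by rw [hji, abs_neg]
      by_cases h1 : p i = 0
      · have := hpK j fun h2 => h (by rw [h1, h2, sub_zero])
        omega
      · have := hpK i h1
        omega
    · exact absurd (if_neg hij) h
  · obtain ⟨k, rfl⟩ : ∃ k : ℕ, i = k + 3 := ⟨(i - 3).toNat, by omega⟩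
    have h1 : p (k + 3 - 1) = u k := by
      simp only [hp]
      rw [if_neg (by omega), if_pos (by omega)]
      congr 1
      omega
    have h2 : p (k + 3) = u (k + 1) := by
      simp only [hp]
      rw [if_neg (by omega), if_pos (by omega)]
      congr 1
      omega
    rw [act, if_pos (by ring), if_pos (by ring), h1, h2, hp0 _ (by omega), hp0 _ (by omega), hu k,
      show (1 - ((k : ℤ) + 3)) = -(k + 2) by ring]
    have : (k : 𝕜) + 1 ≠ 0 := by exact_mod_cast Nat.succ_ne_zero k
    push_cast
    field_simp
    ring
  · rw [act, if_pos (by norm_num), if_pos (by norm_num), hp0 (1 - 1) (by norm_num),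
      hp0 0 le_rfl, hp0 (0 - 1) (by norm_num)]
    simp only [hp]
    norm_num
    ring

/-- The values at `±1` and `±2` suffice. Write `a, b, e, f` for the coordinates of `c` at `1, -1, 2,
-2`. The relations for `[l_1, l_{-1}]`, `[l_{-1}, l_2]` and `[l_1, l_{-2}]` are recursions that
finite support starts at infinity; skewness reflects the result to the other half-line. -/
theorem IsCocycle.eq_zero {c : ℤ → ℤ → ℤ → 𝕜} (hc : IsCocycle c) (h0 : ∀ i j, c 0 i j = 0)
    (hw : ∀ m i j, i + j ≠ m → c m i j = 0) (h1 : ∀ i, 3 ≤ i → c 1 i (1 - i) = 0)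
    (h1' : c 1 1 0 = 0) (m i j : ℤ) : c m i j = 0 := by
  have hbd : ∀ m, ∃ K : ℤ, ∀ i j, K ≤ i → c m i j = 0 := by
    intro m
    obtain ⟨_, K, hK⟩ := hc.isBivector m
    refine ⟨K + 1, fun i j hi => ?_⟩
    by_contra h
    have := abs_le.1 (hK _ _ h).1
    omega
  have hskew : ∀ m i j, c m j i = -c m i j := fun m => (hc.isBivector m).skew
  obtain ⟨a, ha⟩ : ∃ a : ℤ → 𝕜, ∀ i j, i + j = 1 → c 1 i j = a i :=
    ⟨fun i => c 1 i (1 - i), fun i j h => by rw [show j = 1 - i by omega]⟩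
  obtain ⟨b, hb⟩ : ∃ a : ℤ → 𝕜, ∀ i j, i + j = -1 → c (-1) i j = a i :=
    ⟨fun i => c (-1) i (-1 - i), fun i j h => by rw [show j = -1 - i by omega]⟩
  obtain ⟨e, he⟩ : ∃ a : ℤ → 𝕜, ∀ i j, i + j = 2 → c 2 i j = a i :=
    ⟨fun i => c 2 i (2 - i), fun i j h => by rw [show j = 2 - i by omega]⟩
  obtain ⟨f, hf⟩ : ∃ a : ℤ → 𝕜, ∀ i j, i + j = -2 → c (-2) i j = a i :=
    ⟨fun i => c (-2) i (-2 - i), fun i j h => by rw [show j = -2 - i by omega]⟩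
  have sa : ∀ i, a (1 - i) = -a i := fun i => by
    rw [← ha i (1 - i) (by ring), ← ha (1 - i) i (by ring), hskew]
  have sb : ∀ i, b (-1 - i) = -b i := fun i => by
    rw [← hb i (-1 - i) (by ring), ← hb (-1 - i) i (by ring), hskew]
  have se : ∀ i, e (2 - i) = -e i := fun i => by
    rw [← he i (2 - i) (by ring), ← he (2 - i) i (by ring), hskew]
  have sf : ∀ i, f (-2 - i) = -f i := fun i => by
    rw [← hf i (-2 - i) (by ring), ← hf (-2 - i) i (by ring), hskew]
  have E1 : ∀ i : ℤ, (2 - (i : 𝕜)) * b (i - 1) + (2 + i) * b i =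
      (-2 - i) * a (i + 1) + (i - 2) * a i := by
    intro i
    have h := hc.cocycle 1 (-1) i (-i)
    rw [show (1 : ℤ) + -1 = 0 by norm_num, h0, act, act, hb _ _ (by ring), hb _ _ (by ring),
      ha _ _ (by ring), ha _ _ (by ring), sub_neg_eq_add] at h
    push_cast at h
    linear_combination -h
  have E2 : ∀ i : ℤ, -3 * a i = -(2 + (i : 𝕜)) * e (i + 1) + (i - 3) * e i -
      ((4 - i) * b (i - 2) + (3 + i) * b i) := by
    intro i
    have h := hc.cocycle (-1) 2 i (1 - i)
    rw [show (-1 : ℤ) + 2 = 1 by norm_num, act, act, hb _ _ (by ring), hb _ _ (by ring),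
      he _ _ (by ring), he _ _ (by ring), ha _ _ (by ring), sub_neg_eq_add] at h
    push_cast at h
    linear_combination h
  have E3 : ∀ i : ℤ, 3 * b i = (2 - (i : 𝕜)) * f (i - 1) + (3 + i) * f i -
      ((-4 - i) * a (i + 2) + (i - 3) * a i) := by
    intro i
    have h := hc.cocycle 1 (-2) i (-1 - i)
    rw [show (1 : ℤ) + -2 = -1 by norm_num, act, act, hf _ _ (by ring), hf _ _ (by ring),
      ha _ _ (by ring), ha _ _ (by ring), hb _ _ (by ring), sub_neg_eq_add] at h
    push_cast at h
    linear_combination h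
  have a3 : ∀ i, 3 ≤ i → a i = 0 := fun i hi => by rw [← ha i (1 - i) (by ring), h1 i hi]
  have a1 : a 1 = 0 := by rw [← ha 1 0 (by ring), h1']
  have ne : ∀ i : ℤ, i ≠ 0 → (i : 𝕜) ≠ 0 := fun i hi => by exact_mod_cast hi
  -- Each descent stops where its leading coefficient vanishes: `1 - i` for `b` and `f`, `i - 3` for
  -- `e`.
  have b2 : ∀ i, 2 ≤ i → b i = 0 := by
    obtain ⟨K, hK⟩ := hbd (-1)
    refine Int.forall_ge_of_descend (K := K)
      (fun i hi => by rw [← hb i (-1 - i) (by ring), hK _ _ hi]) fun i hi h => ?_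
    have := E1 (i + 1)
    rw [h, a3 _ (by omega), a3 _ (by omega), add_sub_cancel_right] at this
    have h2 := ne (1 - i) (by omega)
    push_cast at this h2
    refine (mul_eq_zero.1 (?_ : (1 - (i : 𝕜)) * b i = 0)).resolve_left h2
    linear_combination this
  have e4 : ∀ i, 4 ≤ i → e i = 0 := by
    obtain ⟨K, hK⟩ := hbd 2
    refine Int.forall_ge_of_descend (K := K)
      (fun i hi => by rw [← he i (2 - i) (by ring), hK _ _ hi]) fun i hi h => ?_
    have := E2 i
    rw [h, a3 _ (by omega), b2 _ (by omega), b2 _ (by omega)] at this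
    have h2 := ne (i - 3) (by omega)
    push_cast at h2
    refine (mul_eq_zero.1 (?_ : ((i : 𝕜) - 3) * e i = 0)).resolve_left h2
    linear_combination -this
  have f2 : ∀ i, 2 ≤ i → f i = 0 := by
    obtain ⟨K, hK⟩ := hbd (-2)
    refine Int.forall_ge_of_descend (K := K)
      (fun i hi => by rw [← hf i (-2 - i) (by ring), hK _ _ hi]) fun i hi h => ?_
    have := E3 (i + 1)
    rw [h, a3 _ (by omega), a3 _ (by omega), b2 _ (by omega), add_sub_cancel_right] at this
    have h2 := ne (1 - i) (by omega)
    push_cast at this h2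
    refine (mul_eq_zero.1 (?_ : (1 - (i : 𝕜)) * f i = 0)).resolve_left h2
    linear_combination -this
  have two : ∀ x : 𝕜, 2 * x = 0 → x = 0 := fun x hx => by simpa using hx
  -- The vanishing coefficients now help: `E3` at `2` loses `f 1` and isolates the missing `a 2`;
  -- `E2` at `3` loses `e 3` and isolates `b 1`.
  have a2 : a 2 = 0 := by
    have := E3 2
    rw [b2 2 le_rfl, f2 2 le_rfl, a3 _ (by norm_num)] at this
    push_cast at this
    linear_combination -this
  have hb1 : b 1 = 0 := by
    have := E2 3
    rw [a3 3 le_rfl, e4 _ (by norm_num), b2 3 (by norm_num), show (3 : ℤ) - 2 = 1 by norm_num]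
      at this
    push_cast at this
    linear_combination this
  have hb0 : b 0 = 0 := by
    have := E1 1
    rw [show (1 : ℤ) + 1 = 2 by norm_num, show (1 : ℤ) - 1 = 0 by norm_num, hb1, a1, a2] at this
    push_cast at this
    linear_combination this
  have az : ∀ i, a i = 0 := by
    have hpos : ∀ i, 1 ≤ i → a i = 0 := by
      intro i hi
      rcases (by omega : i = 1 ∨ i = 2 ∨ 3 ≤ i) with rfl | rfl | h
      exacts [a1, a2, a3 i h]
    intro i
    rcases le_or_gt 1 i with h | h
    · exact hpos i h
    · rw [← neg_eq_zero, ← sa, hpos _ (by omega)]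
  have bz : ∀ i, b i = 0 := by
    have hpos : ∀ i, 0 ≤ i → b i = 0 := by
      intro i hi
      rcases (by omega : i = 0 ∨ i = 1 ∨ 2 ≤ i) with rfl | rfl | h
      exacts [hb0, hb1, b2 i h]
    intro i
    rcases le_or_gt 0 i with h | h
    · exact hpos i h
    · rw [← neg_eq_zero, ← sb, hpos _ (by omega)]
  have ez : ∀ i, e i = 0 := by
    have he1 : e 1 = 0 := by
      have := se 1
      rw [show (2 : ℤ) - 1 = 1 by norm_num] at this
      exact two _ (by linear_combination this)
    have he2 : e 2 = 0 := by
      have := E2 1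
      rw [az, bz, bz, he1, show (1 : ℤ) + 1 = 2 by norm_num] at this
      push_cast at this
      linear_combination this / 3
    have he3 : e 3 = 0 := by
      have := E2 2
      rw [az, bz, bz, he2, show (2 : ℤ) + 1 = 3 by norm_num] at this
      push_cast at this
      linear_combination this / 4
    have hpos : ∀ i, 1 ≤ i → e i = 0 := by
      intro i hi
      rcases (by omega : i = 1 ∨ i = 2 ∨ i = 3 ∨ 4 ≤ i) with rfl | rfl | rfl | h
      exacts [he1, he2, he3, e4 i h]
    intro i
    rcases le_or_gt 1 i with h | h
    · exact hpos i h
    · rw [← neg_eq_zero, ← se, hpos _ (by omega)]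
  have fz : ∀ i, f i = 0 := by
    have hf1 : f (-1) = 0 := by
      have := sf (-1)
      rw [show (-2 : ℤ) - -1 = -1 by norm_num] at this
      exact two _ (by linear_combination this)
    have hf0 : f 0 = 0 := by
      have := E3 0
      rw [az, az, bz, show (0 : ℤ) - 1 = -1 by norm_num, hf1] at this
      push_cast at this
      linear_combination -this / 3
    have hf1' : f 1 = 0 := by
      have := E3 1
      rw [az, az, bz, show (1 : ℤ) - 1 = 0 by norm_num, hf0] at this
      push_cast at this
      linear_combination -this / 4
    have hpos : ∀ i, -1 ≤ i → f i = 0 := by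
      intro i hi
      rcases (by omega : i = -1 ∨ i = 0 ∨ i = 1 ∨ 2 ≤ i) with rfl | rfl | rfl | h
      exacts [hf1, hf0, hf1', f2 i h]
    intro i
    rcases le_or_gt (-1) i with h | h
    · exact hpos i h
    · rw [← neg_eq_zero, ← sf, hpos _ (by omega)]
  revert i j
  refine Int.induction_of_witt_generators (P := fun m => ∀ i j, c m i j = 0) ?_ ?_ ?_ ?_ ?_ m
  · intro i j
    by_cases h : i + j = 1
    · rw [ha _ _ h, az]
    · exact hw _ _ _ h
  · intro i j
    by_cases h : i + j = 2
    · rw [he _ _ h, ez]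
    · exact hw _ _ _ h
  · intro i j
    by_cases h : i + j = -1
    · rw [hb _ _ h, bz]
    · exact hw _ _ _ h
  · intro i j
    by_cases h : i + j = -2
    · rw [hf _ _ h, fz]
    · exact hw _ _ _ h
  · intro m n hm hn hmn i j
    have h := hc.cocycle m n i j
    rw [act, act, hm, hm, hn, hn] at h
    have h2 := ne (m - n) (sub_ne_zero.2 hmn)
    push_cast at h2
    refine (mul_eq_zero.1 (?_ : ((m : 𝕜) - n) * c (m + n) i j = 0)).resolve_left h2
    linear_combination h

/-- `H¹` of the Witt algebra with values in its bivectors vanishes, in coordinates. -/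
theorem IsCocycle.exists_eq_act {c : ℤ → ℤ → ℤ → 𝕜} (hc : IsCocycle c) :
    ∃ r, IsBivector r ∧ ∀ m i j, c m i j = act m r i j := by
  obtain ⟨r, hr, h0, hw⟩ := hc.exists_homogeneous
  have hd := hc.sub_act hr
  obtain ⟨t, ht, htw, ht3, ht1⟩ := (hd.isBivector 1).exists_act_one
  refine ⟨fun i j => r i j + t i j, hr.add ht, fun m i j => ?_⟩
  have key := (hd.sub_act ht).eq_zero (fun i j => ?_) (fun m i j h => ?_)
    (fun i hi => sub_eq_zero.2 (ht3 i hi)) (sub_eq_zero.2 ht1) m i j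
  · rw [act_add]
    linear_combination key
  · rw [h0, act, sub_zero, sub_zero]
    by_cases hij : i + j = 0
    · have : (i : 𝕜) + j = 0 := by exact_mod_cast hij
      push_cast
      linear_combination t i j * this
    · rw [htw i j hij]
      ring
  · rw [hw m i j h, act, htw _ _ (by omega), htw _ _ (by omega)]
    ring

end Witt

/-! ### Coordinates of bivectors -/

namespace BMS4

open Gen

/-- A Witt-equivariant family of elements `∑ j, d p j • t_{p - j} ⊗ l_j` vanishes. -/
theorem eq_zero_of_equivariant {𝕜 : Type*} [Field 𝕜] [CharZero 𝕜] {d : ℤ → ℤ → 𝕜}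
    (hfin : ∀ p, ∃ K : ℤ, ∀ j, d p j ≠ 0 → |j| ≤ K)
    (hd : ∀ m p j : ℤ, (((m : 𝕜) + 1) / 2 - p) * d (p + m) j =
      (((m : 𝕜) + 1) / 2 - p + j) * d p j + (2 * m - j) * d p (j - m)) (p j : ℤ) : d p j = 0 := by
  obtain ⟨K, hK⟩ := hfin p
  by_contra h0
  have hj := hK j h0
  have hj' := abs_le.1 hj
  have hK0 : 0 ≤ K := (abs_nonneg j).trans hj
  have hp := abs_nonneg p
  have hp' := le_abs_self p
  have hp'' := neg_abs_le p
  -- Large enough that `j ± m` leave the support of `d p`, that `(m + 1) / 2 - p ≠ 0`, and that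
  -- `2m²` dominates the final polynomial.
  obtain ⟨m, hm⟩ : ∃ m : ℤ, m = 2 * K + 2 * |p| + 2 := ⟨_, rfl⟩
  have z1 : d p (j + m) = 0 := by
    by_contra h
    have := abs_le.1 (hK _ h)
    omega
  have z2 : d p (j - m) = 0 := by
    by_contra h
    have := abs_le.1 (hK _ h)
    omega
  -- Applying `l_m` and then `l_{-m}`: `e1` and `e2` express `d (p + m) j` and `d (p + m) (j + m)`
  -- through `d p j`. Substituting into `e3` eliminates them, so no bound on the support of `d (p +
  -- m)` is needed.
  have e1 := hd m p j
  have e2 := hd m p (j + m)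
  have e3 := hd (-m) (p + m) j
  rw [z2, mul_zero, add_zero] at e1
  rw [z1, mul_zero, zero_add, add_sub_cancel_right] at e2
  rw [add_neg_cancel_right, sub_neg_eq_add] at e3
  push_cast at e1 e2 e3
  have hA : ((m : 𝕜) + 1) / 2 - p ≠ 0 := by
    intro h
    have h' : (m : 𝕜) + 1 - 2 * p = 0 := by linear_combination 2 * h
    have : m + 1 - 2 * p = 0 := by exact_mod_cast h'
    omega
  have hmain : (2 * (m : 𝕜) ^ 2 + (2 * p - 1) * j - 2 * j ^ 2) * d p j = 0 := by
    linear_combination (((m : 𝕜) + 1) / 2 - p) * e3 +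
      ((-(m : 𝕜) + 1) / 2 - (p + m) + j) * e1 + (-2 * (m : 𝕜) - j) * e2
  refine mul_ne_zero ?_ h0 hmain
  have : 2 * m ^ 2 + (2 * p - 1) * j - 2 * j ^ 2 ≠ 0 := by
    have h1 : (2 * p - 1) * j ≥ -((2 * |p| + 1) * K) := by
      have : |(2 * p - 1) * j| ≤ (2 * |p| + 1) * K := by
        rw [abs_mul]
        exact mul_le_mul (abs_le.2 ⟨by omega, by omega⟩) hj (abs_nonneg j) (by omega)
      exact (abs_le.1 this).1
    have h2 : j ^ 2 ≤ K ^ 2 := sq_le_sq' hj'.1 hj'.2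
    have h3 : 0 ≤ K * |p| := mul_nonneg hK0 hp
    have h4 := sq_nonneg |p|
    have h5 : m ^ 2 = 4 * K ^ 2 + 4 * |p| ^ 2 + 4 + 8 * (K * |p|) + 8 * K + 8 * |p| := by
      rw [hm]; ring
    have h6 := sq_nonneg K
    intro h
    nlinarith
  exact_mod_cast this

variable {𝕜 : Type*} [Field 𝕜]

/-- The coordinate of a bivector at a pair of generators. -/
noncomputable def bicoef (a b : Gen) : ⋀[𝕜]^2 (BMS4 𝕜) →ₗ[𝕜] 𝕜 :=
  exteriorPower.coef (basis 𝕜) 2 ![a, b]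

theorem bicoef_wedge (a b : Gen) (x y : BMS4 𝕜) :
    bicoef a b (exteriorPower.ιMulti 𝕜 2 ![x, y]) =
      (basis 𝕜).repr x a * (basis 𝕜).repr y b - (basis 𝕜).repr x b * (basis 𝕜).repr y a := by
  rw [bicoef, exteriorPower.coef_ιMulti, Matrix.det_fin_two]
  rfl

theorem bicoef_ext {ω η : ⋀[𝕜]^2 (BMS4 𝕜)} (h : ∀ a b, bicoef a b ω = bicoef a b η) : ω = η := by
  refine sub_eq_zero.1 (exteriorPower.eq_zero_of_coef_eq_zero (basis 𝕜) fun a => ?_)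
  have : a = ![a 0, a 1] := by ext i; fin_cases i <;> rfl
  rw [this, map_sub, sub_eq_zero]
  exact h _ _

theorem finite_bicoef (ω : ⋀[𝕜]^2 (BMS4 𝕜)) :
    {x : Gen × Gen | bicoef x.1 x.2 ω ≠ 0}.Finite := by
  refine (exteriorPower.finite_coef_ne_zero (basis 𝕜) ω).preimage
    (f := fun x : Gen × Gen => ![x.1, x.2]) ?_
  intro x _ y _ h
  exact Prod.ext (congrFun h 0) (congrFun h 1)

theorem bicoef_idx_bound (ω : ⋀[𝕜]^2 (BMS4 𝕜)) (s : Bool) :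
    ∃ K : ℤ, 0 ≤ K ∧ ∀ a b, bicoef a b ω ≠ 0 → |idx s a| ≤ K ∧ |idx s b| ≤ K := by
  obtain ⟨K, h0, hK⟩ := exists_idx_bound (exteriorPower.finite_coef_ne_zero (basis 𝕜) ω) s
  exact ⟨K, h0, fun a b h => ⟨hK _ h 0, hK _ h 1⟩⟩

variable [CharZero 𝕜]

theorem bicoef_skew (a b : Gen) (ω : ⋀[𝕜]^2 (BMS4 𝕜)) : bicoef b a ω = -bicoef a b ω := by
  induction ω using LieBialg.bivector_induction with
  | wedge x y => rw [bicoef_wedge, bicoef_wedge]; ring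
  | zero => simp
  | add r s hr hs => rw [map_add, map_add, hr, hs, neg_add]
  | smul c r hr => rw [map_smul, map_smul, hr, smul_neg]

theorem exists_bicoef_eq {F : Gen → Gen → 𝕜} (hF : ∀ a b, F b a = -F a b)
    (hfin : {x : Gen × Gen | F x.1 x.2 ≠ 0}.Finite) :
    ∃ ω : ⋀[𝕜]^2 (BMS4 𝕜), ∀ a b, bicoef a b ω = F a b := by
  classical
  -- The factor `1 / 2` compensates for each unordered pair occurring in both orders.
  refine ⟨∑ x ∈ hfin.toFinset, (F x.1 x.2 / 2) •
    exteriorPower.ιMulti 𝕜 2 ![basis 𝕜 x.1, basis 𝕜 x.2], fun a b => ?_⟩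
  have hsum : ∀ a b, ∑ x ∈ hfin.toFinset, F x.1 x.2 / 2 *
      ((basis 𝕜).repr (basis 𝕜 x.1) a * (basis 𝕜).repr (basis 𝕜 x.2) b) = F a b / 2 := by
    intro a b
    rw [Finset.sum_eq_single (a, b)]
    · simp
    · rintro ⟨c, d⟩ _ h
      by_cases hc : c = a
      · have hd : d ≠ b := fun hd => h (by rw [hc, hd])
        simp [hd]
      · simp [hc]
    · intro h
      have h0 : F a b = 0 := by simpa using h
      simp [h0]
  simp only [map_sum, map_smul, bicoef_wedge, smul_eq_mul, mul_sub, Finset.sum_sub_distrib]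
  rw [hsum, hsum, hF a b]
  ring

theorem bicoef_lie (s : Bool) (m : ℤ) (a b : Gen) (ω : ⋀[𝕜]^2 (BMS4 𝕜)) :
    bicoef a b ⁅witt 𝕜 s m, ω⁆ =
      weight 𝕜 s m (shift s (-m) a) * bicoef (shift s (-m) a) b ω +
      weight 𝕜 s m (shift s (-m) b) * bicoef a (shift s (-m) b) ω := by
  rw [bicoef, coef_lie_witt, Fin.sum_univ_two]
  congr 3

theorem bicoef_lie_of_not_moved {s : Bool} {a b : Gen} (ha : ¬Moved s a) (hb : ¬Moved s b) (m : ℤ)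
    (ω : ⋀[𝕜]^2 (BMS4 𝕜)) : bicoef a b ⁅witt 𝕜 s m, ω⁆ = 0 := by
  rw [bicoef_lie, weight_of_not_moved 𝕜 (by simpa using ha), weight_of_not_moved 𝕜 (by simpa using hb),
    zero_mul, zero_mul, add_zero]

theorem bicoef_eq_zero_of_lie {s : Bool} {a b : Gen} (ha : Moved s a) {ω : ⋀[𝕜]^2 (BMS4 𝕜)}
    (h : ∀ m, bicoef (shift s m a) b ⁅witt 𝕜 s m, ω⁆ = 0) : bicoef a b ω = 0 := by
  obtain ⟨K, hK0, hK⟩ := bicoef_idx_bound ω s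
  by_contra hne
  have h1 := abs_le.1 (hK a b hne).1
  have hm := h (2 * K + 1)
  rw [bicoef_lie, shift_neg_shift, show bicoef (shift s (2 * K + 1) a) _ ω = 0 from ?_, mul_zero,
    add_zero] at hm
  · exact mul_ne_zero (weight_ne_zero 𝕜 ha (by have := (hK a b hne).1; omega)) hne hm
  · by_contra h0
    have h2 := (hK _ _ h0).1
    rw [idx_shift ha] at h2
    have h3 := abs_le.1 h2
    omega

end BMS4

/-! ### Cocycles with values in bivectors -/

namespace BMS4

open Gen LieBialg

variable {𝕜 : Type*} [Field 𝕜] [CharZero 𝕜]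

/-- The 1-cocycle condition for maps into bivectors. -/
def IsBicocycle (δ : BMS4 𝕜 →ₗ[𝕜] ⋀[𝕜]^2 (BMS4 𝕜)) : Prop :=
  ∀ x y, δ ⁅x, y⁆ = ⁅x, δ y⁆ - ⁅y, δ x⁆

theorem IsBicocycle.sub_cobracketOf {δ : BMS4 𝕜 →ₗ[𝕜] ⋀[𝕜]^2 (BMS4 𝕜)} (hδ : IsBicocycle δ)
    (r : ⋀[𝕜]^2 (BMS4 𝕜)) : IsBicocycle (δ - cobracketOf r) := by
  intro x y
  simp only [LinearMap.sub_apply, hδ x y, cobracketOf_cocycle, lie_sub]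
  abel

theorem IsBicocycle.lie_comm {δ : BMS4 𝕜 →ₗ[𝕜] ⋀[𝕜]^2 (BMS4 𝕜)} (hδ : IsBicocycle δ) (s : Bool)
    (m n : ℤ) : ⁅witt 𝕜 s m, δ (witt 𝕜 (!s) n)⁆ = ⁅witt 𝕜 (!s) n, δ (witt 𝕜 s m)⁆ := by
  have h := hδ (witt 𝕜 s m) (witt 𝕜 (!s) n)
  rw [lie_witt_witt_not, map_zero] at h
  exact (sub_eq_zero.1 h.symm)

theorem IsBicocycle.lie_witt {δ : BMS4 𝕜 →ₗ[𝕜] ⋀[𝕜]^2 (BMS4 𝕜)} (hδ : IsBicocycle δ) (s : Bool)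
    (m n : ℤ) : ((m : 𝕜) - n) • δ (witt 𝕜 s (m + n)) =
      ⁅witt 𝕜 s m, δ (witt 𝕜 s n)⁆ - ⁅witt 𝕜 s n, δ (witt 𝕜 s m)⁆ := by
  rw [← hδ, lie_witt_witt, map_smul]

/-- Solving `δ(l_m) = l_m · R` for finitely many `m` on the coordinates where the first index is
moved by the `l_i` and the second one by the `l̄_i`, by comparison with `δ(l̄_n)` for large `n`. -/
theorem IsBicocycle.exists_primitive {δ : BMS4 𝕜 →ₗ[𝕜] ⋀[𝕜]^2 (BMS4 𝕜)} (hδ : IsBicocycle δ)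
    (G : Finset ℤ) : ∃ R : Gen → Gen → 𝕜, {x : Gen × Gen | R x.1 x.2 ≠ 0}.Finite ∧
      (∀ a b, ¬(Moved true a ∧ Moved false b) → R a b = 0) ∧
      ∀ m ∈ G, ∀ a b, Moved true a → Moved false b → bicoef a b (δ (witt 𝕜 true m)) =
        weight 𝕜 true m (shift true (-m) a) * R (shift true (-m) a) b +
        weight 𝕜 true m (shift true (-m) b) * R a (shift true (-m) b) := by
  classical
  choose κ hκ0 hκ using fun m => bicoef_idx_bound (δ (witt 𝕜 true m)) false
  obtain ⟨K, hK0, hK⟩ : ∃ K : ℤ, 0 ≤ K ∧ ∀ m ∈ G, κ m ≤ K :=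
    ⟨∑ m ∈ G, κ m, Finset.sum_nonneg fun m _ => hκ0 m,
      fun m hm => Finset.single_le_sum (fun m _ => hκ0 m) hm⟩
  -- For `|idx b| ≤ K` this makes the weight of `l̄_n` on `b` nonzero and pushes `b` shifted by `n`
  -- out of the support of every `δ(l_m)`, `m ∈ G`. The commutation relation at `(a, b + n)` then
  -- reads `δ(l_m) = l_m · R`. Truncating at `K` is harmless since `l_m` preserves the `l̄` index.
  set n := 2 * K + 1 with hn
  refine ⟨fun a b => if Moved true a ∧ Moved false b ∧ |idx false b| ≤ K then
    bicoef a (shift false n b) (δ (witt 𝕜 false n)) / weight 𝕜 false n b else 0, ?_, ?_, ?_⟩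
  · refine ((finite_bicoef (δ (witt 𝕜 false n))).preimage
      (f := fun x : Gen × Gen => (x.1, shift false n x.2)) ?_).subset ?_
    · intro x _ y _ h
      have h2 := congrArg (shift false (-n)) (congrArg Prod.snd h)
      simp only [shift_neg_shift] at h2
      exact Prod.ext (congrArg Prod.fst h :) h2
    · rintro ⟨a, b⟩ h h0
      refine h ?_
      have h0' : bicoef a (shift false n b) (δ (witt 𝕜 false n)) = 0 := h0
      simp only [h0', zero_div, ite_self]
  · intro a b h
    exact if_neg fun h' => h ⟨h'.1, h'.2.1⟩
  · intro m hm a b ha hb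
    have hidx : ∀ c, idx false (shift true (-m) c) = idx false c := fun c => idx_shift_not true _ c
    have hwt : ∀ c, weight 𝕜 false n (shift true (-m) c) = weight 𝕜 false n c :=
      fun c => weight_shift_not 𝕜 true _ _ c
    have hwt' : ∀ c, weight 𝕜 true m (shift false n c) = weight 𝕜 true m c :=
      fun c => weight_shift_not 𝕜 false _ _ c
    simp only [moved_shift, hidx, hwt, ha, hb, true_and]
    by_cases hbK : |idx false b| ≤ K
    · have hw : weight 𝕜 false n b ≠ 0 := weight_ne_zero 𝕜 hb (by omega)
      simp only [hbK, if_true]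
      have h := congrArg (bicoef a (shift false n b)) (hδ.lie_comm true m n)
      rw [Bool.not_true, bicoef_lie, bicoef_lie, shift_neg_shift,
        show bicoef _ (shift false n b) (δ (witt 𝕜 true m)) = 0 from ?_, mul_zero, zero_add,
        shift_comm true false, hwt'] at h
      · field_simp
        linear_combination -h
      · by_contra h0
        have h1 := (hκ _ _ _ h0).2
        rw [idx_shift hb] at h1
        have h2 := abs_le.1 (h1.trans (hK m hm))
        have h3 := abs_le.1 hbK
        omega
    · simp only [hbK, if_false, mul_zero, add_zero]
      by_contra h0
      exact hbK ((hκ _ _ _ h0).2.trans (hK m hm))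

theorem IsBicocycle.exists_mixed {δ : BMS4 𝕜 →ₗ[𝕜] ⋀[𝕜]^2 (BMS4 𝕜)} (hδ : IsBicocycle δ) :
    ∃ r : ⋀[𝕜]^2 (BMS4 𝕜), ∀ m a b, Moved true a → Moved false b →
      bicoef a b ((δ - cobracketOf r) (witt 𝕜 true m)) = 0 := by
  classical
  obtain ⟨R, hfin, hR0, hR⟩ := hδ.exists_primitive {1, 2, -1, -2}
  set V : Gen → Gen → Prop := fun a b => Moved true a ∧ Moved false b with hV
  -- Skew-symmetrizing `R` counts a pair twice exactly when both orders are mixed, that is, when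
  -- both entries are supertranslations.
  set N : Gen → Gen → 𝕜 := fun a b => if V a b ∧ V b a then 1 / 2 else 1 with hN
  obtain ⟨r, hr⟩ := exists_bicoef_eq (F := fun a b => N a b * (R a b - R b a))
    (fun a b => by simp only [hN, and_comm (a := V b a)]; ring)
    ((hfin.union (hfin.preimage Prod.swap_injective.injOn)).subset fun x hx => by
      by_contra hc
      simp only [Set.mem_union, Set.mem_ofPred_eq, Set.mem_preimage, Prod.fst_swap, Prod.snd_swap,
        not_or, not_not] at hc
      exact hx (by simp only [hc.1, hc.2, sub_zero, mul_zero]))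
  refine ⟨r, ?_⟩
  have hG : ∀ m ∈ ({1, 2, -1, -2} : Finset ℤ), ∀ a b, Moved true a → Moved false b →
      bicoef a b ((δ - cobracketOf r) (witt 𝕜 true m)) = 0 := by
    intro m hm a b ha hb
    rw [LinearMap.sub_apply, map_sub, cobracketOf_apply, bicoef_lie, hr, hr, hR m hm a b ha hb]
    have hN1 : N (shift true (-m) a) b = N a b := by simp only [hN, hV, moved_shift]
    have hN2 : N a (shift true (-m) b) = N a b := by simp only [hN, hV, moved_shift]
    rw [hN1, hN2]
    by_cases hba : V b a
    · have h2 := hR m hm b a hba.1 hba.2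
      rw [bicoef_skew, hR m hm a b ha hb] at h2
      rw [show N a b = 1 / 2 from if_pos ⟨⟨ha, hb⟩, hba⟩]
      linear_combination (1 / 2 : 𝕜) * (-h2)
    · rw [show N a b = 1 from if_neg fun h => hba h.2, hR0 b _ (by simpa [hV] using hba),
        hR0 _ a (by simpa [hV] using hba)]
      ring
  have hδ' := hδ.sub_cobracketOf r
  -- The primitive needs a support bound uniform in `m`, so it was built only for Witt generators;
  -- the cocycle relation carries the vanishing to all `m`.
  refine Int.induction_of_witt_generators (hG 1 (by simp)) (hG 2 (by simp)) (hG (-1) (by simp))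
    (hG (-2) (by simp)) ?_
  intro m n hm hn hmn a b ha hb
  have h := congrArg (bicoef a b) (hδ'.lie_witt true m n)
  rw [map_smul, map_sub, bicoef_lie, bicoef_lie, hm _ _ (by simpa) hb, hm _ _ ha (by simpa),
    hn _ _ (by simpa) hb, hn _ _ ha (by simpa), smul_eq_mul] at h
  have h2 : (m : 𝕜) - n ≠ 0 := sub_ne_zero.2 (by exact_mod_cast hmn)
  refine (mul_eq_zero.1 (h.trans ?_)).resolve_left h2
  ring

/-- A cocycle whose mixed coordinates vanish on the `l_m` takes values in the bivectors of the
respective Witt algebra. -/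
theorem IsBicocycle.not_moved {δ : BMS4 𝕜 →ₗ[𝕜] ⋀[𝕜]^2 (BMS4 𝕜)} (hδ : IsBicocycle δ)
    (h : ∀ m a b, Moved true a → Moved false b → bicoef a b (δ (witt 𝕜 true m)) = 0)
    (s : Bool) (m : ℤ) (a b : Gen) (hab : Moved (!s) a ∨ Moved (!s) b) :
    bicoef a b (δ (witt 𝕜 s m)) = 0 := by
  have hmixed : ∀ s m a b, Moved true a → Moved false b → bicoef a b (δ (witt 𝕜 s m)) = 0 := by
    intro s m a b ha hb
    cases s with
    | true => exact h m a b ha hb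
    | false =>
      -- `l_n · δ(l̄_m) = l̄_m · δ(l_n)` has no mixed coordinates, so the mixed part of `δ(l̄_m)` is
      -- killed by all `l_n`.
      refine bicoef_eq_zero_of_lie (s := true) ha fun n => ?_
      have hc := hδ.lie_comm true n m
      rw [Bool.not_true] at hc
      rw [hc, bicoef_lie, h _ _ _ (by simpa) hb, h _ _ _ (by simpa) (by simpa)]
      ring
  have hskew : ∀ s m a b, Moved true a → Moved false b → bicoef b a (δ (witt 𝕜 s m)) = 0 :=
    fun s m a b ha hb => by rw [bicoef_skew, hmixed s m a b ha hb, neg_zero]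
  by_cases hsab : Moved s a ∨ Moved s b
  · have key : ∀ a b, Moved (!s) a → Moved s b → bicoef a b (δ (witt 𝕜 s m)) = 0 := by
      intro a b ha hb
      cases s with
      | true => exact hskew _ _ _ _ hb ha
      | false => exact hmixed _ _ _ _ ha hb
    have key2 : ∀ a b, Moved (!s) a → Moved s a ∨ Moved s b → bicoef a b (δ (witt 𝕜 s m)) = 0 := by
      intro a b ha h'
      by_cases hb : Moved s b
      · exact key a b ha hb
      · have hb' : Moved (!s) b := by
          obtain ⟨t, ht⟩ := exists_moved b
          cases s <;> cases t <;> simp_all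
        rw [bicoef_skew, key b a hb' (h'.resolve_right hb), neg_zero]
    rcases hab with ha | hb
    · exact key2 a b ha hsab
    · rw [bicoef_skew, key2 b a hb hsab.symm, neg_zero]
  · rw [not_or] at hsab
    -- Here both entries belong to the other Witt algebra. It kills this part of the value, because
    -- the commuting side acts by zero on such coordinates.
    have key : ∀ a b, ¬Moved s a → ¬Moved s b → Moved (!s) a →
        bicoef a b (δ (witt 𝕜 s m)) = 0 := by
      intro a b ha hb ha'
      refine bicoef_eq_zero_of_lie ha' fun n => ?_
      rw [← hδ.lie_comm, bicoef_lie_of_not_moved (by simpa) hb]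
    rcases hab with ha | hb
    · exact key a b hsab.1 hsab.2 ha
    · rw [bicoef_skew, key b a hsab.2 hsab.1 hb, neg_zero]

/-! ### Reduction to bivectors of a single Witt algebra. -/

theorem Gen.exists_eq_witt {s : Bool} {a : Gen} (ha : ¬Moved (!s) a) : ∃ i, a = Gen.witt s i := by
  cases s <;> cases a <;> simp_all [Moved, Gen.witt]

theorem Gen.not_moved_witt (s : Bool) (i : ℤ) : ¬Moved (!s) (Gen.witt s i) := by
  cases s <;> simp [Moved, Gen.witt]

theorem Gen.shift_witt (s : Bool) (m i : ℤ) : shift s m (Gen.witt s i) = Gen.witt s (i + m) := by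
  cases s <;> rfl

theorem Gen.idx_witt (s : Bool) (i : ℤ) : idx s (Gen.witt s i) = i := by
  cases s <;> rfl

theorem weight_witt {𝕜 : Type*} [Field 𝕜] (s : Bool) (m i : ℤ) : weight 𝕜 s m (Gen.witt s i) = m - i := by
  cases s <;> rfl

theorem bicoef_lie_witt (s : Bool) (m i j : ℤ) (ω : ⋀[𝕜]^2 (BMS4 𝕜)) :
    bicoef (Gen.witt s i) (Gen.witt s j) ⁅witt 𝕜 s m, ω⁆ =
      Witt.act m (fun i j => bicoef (Gen.witt s i) (Gen.witt s j) ω) i j := by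
  rw [bicoef_lie, shift_witt, shift_witt, weight_witt, weight_witt, Witt.act]
  push_cast
  ring_nf

theorem isBivector_bicoef (s : Bool) (ω : ⋀[𝕜]^2 (BMS4 𝕜)) :
    Witt.IsBivector fun i j => bicoef (Gen.witt s i) (Gen.witt s j) ω := by
  obtain ⟨K, _, hK⟩ := bicoef_idx_bound ω s
  refine ⟨fun i j => bicoef_skew _ _ _, K, fun i j h => ?_⟩
  simpa only [idx_witt] using hK _ _ h

theorem exists_bicoef_witt_eq (s : Bool) {F : ℤ → ℤ → 𝕜} (hF : Witt.IsBivector F) :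
    ∃ ω : ⋀[𝕜]^2 (BMS4 𝕜), (∀ i j, bicoef (Gen.witt s i) (Gen.witt s j) ω = F i j) ∧
      ∀ a b, Moved (!s) a ∨ Moved (!s) b → bicoef a b ω = 0 := by
  classical
  obtain ⟨hs, K, hK⟩ := hF
  obtain ⟨ω, hω⟩ := exists_bicoef_eq
    (F := fun a b => if Moved (!s) a ∨ Moved (!s) b then 0 else F (idx s a) (idx s b))
    (fun a b => by
      simp only [or_comm (a := Moved (!s) b), hs (idx s a)]
      split_ifs <;> simp) (by
      refine ((Set.finite_Icc (-K) K).image2 (fun i j => (Gen.witt s i, Gen.witt s j))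
        (Set.finite_Icc (-K) K)).subset ?_
      rintro ⟨a, b⟩ h
      have hab : ¬(Moved (!s) a ∨ Moved (!s) b) := fun h' => h (if_pos h')
      have h' : F (idx s a) (idx s b) ≠ 0 := fun h0 => h (by simp only [h0, ite_self])
      obtain ⟨h1, h2⟩ := hK _ _ h'
      rw [not_or] at hab
      obtain ⟨i, rfl⟩ := exists_eq_witt hab.1
      obtain ⟨j, rfl⟩ := exists_eq_witt hab.2
      rw [idx_witt] at h1 h2
      exact ⟨i, abs_le.1 h1, j, abs_le.1 h2, rfl⟩)
  refine ⟨ω, fun i j => ?_, fun a b h => ?_⟩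
  · rw [hω, if_neg (by simp [not_moved_witt]), idx_witt, idx_witt]
  · rw [hω, if_pos h]

theorem IsBicocycle.exists_witt {δ : BMS4 𝕜 →ₗ[𝕜] ⋀[𝕜]^2 (BMS4 𝕜)} (hδ : IsBicocycle δ)
    (s : Bool) (h : ∀ m a b, Moved (!s) a ∨ Moved (!s) b → bicoef a b (δ (witt 𝕜 s m)) = 0) :
    ∃ r : ⋀[𝕜]^2 (BMS4 𝕜), (∀ m, δ (witt 𝕜 s m) = ⁅witt 𝕜 s m, r⁆) ∧
      ∀ m, ⁅witt 𝕜 (!s) m, r⁆ = 0 := by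
  have hc : Witt.IsCocycle fun m i j =>
      bicoef (Gen.witt s i) (Gen.witt s j) (δ (witt 𝕜 s m)) := by
    refine ⟨fun m => isBivector_bicoef s _, fun m n i j => ?_⟩
    rw [← bicoef_lie_witt, ← bicoef_lie_witt, ← map_sub, ← hδ.lie_witt, map_smul, smul_eq_mul]
  obtain ⟨F, hF, hcF⟩ := hc.exists_eq_act
  obtain ⟨r, hr, hr0⟩ := exists_bicoef_witt_eq s hF
  refine ⟨r, fun m => bicoef_ext fun a b => ?_, fun m => bicoef_ext fun a b => ?_⟩
  · by_cases hab : Moved (!s) a ∨ Moved (!s) b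
    · rw [h m a b hab, bicoef_lie, hr0 _ _ (by simpa using hab), hr0 _ _ (by simpa using hab)]
      ring
    · rw [not_or] at hab
      obtain ⟨i, rfl⟩ := exists_eq_witt hab.1
      obtain ⟨j, rfl⟩ := exists_eq_witt hab.2
      rw [hcF m i j, bicoef_lie_witt]
      simp only [hr]
  · rw [map_zero]
    by_cases hab : Moved (!s) a ∨ Moved (!s) b
    · rw [bicoef_lie, hr0 _ _ (by simpa using hab), hr0 _ _ (by simpa using hab)]
      ring
    · rw [not_or] at hab
      exact bicoef_lie_of_not_moved hab.1 hab.2 m r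

end BMS4

/-! ### Values on the supertranslations, and vanishing of the first cohomology. -/

namespace BMS4

open Gen LieBialg

variable {𝕜 : Type*} [Field 𝕜] [CharZero 𝕜]

/-- Parity obstruction: `T_{pq}` has half-integral `l_0`-weight, while the `l_i` and `l̄_i` have
integral ones. -/
theorem half_sub_ne (m n : ℤ) : ((0 : ℤ) + 1 : 𝕜) / 2 - m ≠ n := by
  intro h
  have h' : (1 : 𝕜) = 2 * (m + n) := by push_cast at h; linear_combination 2 * h
  have : (1 : ℤ) = 2 * (m + n) := by exact_mod_cast h'
  omega

/-- A cocycle vanishing on both Witt algebras is equivariant, and then it vanishes on the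
supertranslations. -/
theorem IsBicocycle.eq_zero {δ : BMS4 𝕜 →ₗ[𝕜] ⋀[𝕜]^2 (BMS4 𝕜)} (hδ : IsBicocycle δ)
    (h0 : ∀ s m, δ (witt 𝕜 s m) = 0) : δ = 0 := by
  have heq : ∀ s m a, weight 𝕜 s m a • δ (basis 𝕜 (shift s m a)) =
      ⁅witt 𝕜 s m, δ (basis 𝕜 a)⁆ := by
    intro s m a
    rw [← map_smul, ← lie_witt_basis, hδ, h0, lie_zero, sub_zero]
  -- Equivariance under `l_0` and `l̄_0`: only coordinates of matching weight survive.
  have hz : ∀ s g a b, weight 𝕜 s 0 g ≠ weight 𝕜 s 0 a + weight 𝕜 s 0 b →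
      bicoef a b (δ (basis 𝕜 g)) = 0 := by
    intro s g a b hne
    have h := congrArg (bicoef a b) (heq s 0 g)
    rw [map_smul, bicoef_lie, shift_zero, neg_zero, shift_zero, shift_zero, smul_eq_mul,
      ← add_mul] at h
    exact (mul_eq_mul_right_iff.1 h).resolve_left hne
  -- The weights force `q' = q` and `p' = p - j`, which leaves the family excluded by
  -- `eq_zero_of_equivariant`.
  have hTl : ∀ p q p' q' j, bicoef (.T p' q') (.l j) (δ (basis 𝕜 (.T p q))) = 0 := by
    intro p q p' q' j
    by_cases hq : q' = q
    · by_cases hp : p' = p - j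
      · subst hq hp
        refine eq_zero_of_equivariant
          (d := fun p j => bicoef (.T (p - j) q') (.l j) (δ (basis 𝕜 (.T p q'))))
          (fun p => ?_) (fun m p j => ?_) p j
        · obtain ⟨K, _, hK⟩ := bicoef_idx_bound (δ (basis 𝕜 (.T p q'))) true
          exact ⟨K, fun j hj => (hK _ _ hj).2⟩
        · have h := congrArg (bicoef (.T (p + m - j) q') (.l j)) (heq true m (.T p q'))
          rw [map_smul, bicoef_lie] at h
          simp only [shift, weight, smul_eq_mul] at h
          rw [h, show p + m - j + -m = p - j by ring, show p + m - j = p - (j - m) by ring,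
            ← sub_eq_add_neg j m]
          push_cast
          ring
      · refine hz true _ _ _ fun h => hp ?_
        simp only [weight] at h
        have : (p' : 𝕜) = p - j := by push_cast at h; linear_combination h
        exact_mod_cast this
    · refine hz false _ _ _ fun h => hq ?_
      simp only [weight] at h
      have : (q' : 𝕜) = q := by push_cast at h; linear_combination h
      exact_mod_cast this
  have hTlbar : ∀ p q p' q' j, bicoef (.T p' q') (.lbar j) (δ (basis 𝕜 (.T p q))) = 0 := by
    intro p q p' q' j
    by_cases hp : p' = p
    · by_cases hq : q' = q - j
      · subst hq hp
        refine eq_zero_of_equivariant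
          (d := fun q j => bicoef (.T p' (q - j)) (.lbar j) (δ (basis 𝕜 (.T p' q))))
          (fun q => ?_) (fun m q j => ?_) q j
        · obtain ⟨K, _, hK⟩ := bicoef_idx_bound (δ (basis 𝕜 (.T p' q))) false
          exact ⟨K, fun j hj => (hK _ _ hj).2⟩
        · have h := congrArg (bicoef (.T p' (q + m - j)) (.lbar j)) (heq false m (.T p' q))
          rw [map_smul, bicoef_lie] at h
          simp only [shift, weight, smul_eq_mul] at h
          rw [h, show q + m - j + -m = q - j by ring, show q + m - j = q - (j - m) by ring,
            ← sub_eq_add_neg j m]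
          push_cast
          ring
      · refine hz false _ _ _ fun h => hq ?_
        simp only [weight] at h
        have : (q' : 𝕜) = q - j := by push_cast at h; linear_combination h
        exact_mod_cast this
    · refine hz true _ _ _ fun h => hp ?_
      simp only [weight] at h
      have : (p' : 𝕜) = p := by push_cast at h; linear_combination h
      exact_mod_cast this
  have hT : ∀ p q a b, bicoef a b (δ (basis 𝕜 (.T p q))) = 0 := by
    intro p q a b
    cases a with
    | l i =>
      cases b with
      | l j =>
        refine hz true _ _ _ fun h => half_sub_ne p (-i - j) (h.trans ?_)
        simp only [weight]; push_cast; ring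
      | lbar j =>
        refine hz true _ _ _ fun h => half_sub_ne p (-i) (h.trans ?_)
        simp only [weight]; push_cast; ring
      | T p' q' => rw [bicoef_skew, hTl, neg_zero]
    | lbar i =>
      cases b with
      | l j =>
        refine hz true _ _ _ fun h => half_sub_ne p (-j) (h.trans ?_)
        simp only [weight]; push_cast; ring
      | lbar j =>
        refine hz true _ _ _ fun h => half_sub_ne p 0 (h.trans ?_)
        simp only [weight]; push_cast; ring
      | T p' q' => rw [bicoef_skew, hTlbar, neg_zero]
    | T p₁ q₁ =>
      cases b with
      | l j => exact hTl _ _ _ _ _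
      | lbar j => exact hTlbar _ _ _ _ _
      | T p₂ q₂ =>
        refine hz true _ _ _ fun h => half_sub_ne p (1 - p₁ - p₂) (h.trans ?_)
        simp only [weight]; push_cast; ring
  refine (basis 𝕜).ext fun g => ?_
  cases g with
  | l m => exact h0 true m
  | lbar m => exact h0 false m
  | T p q => exact bicoef_ext fun a b => by rw [hT, LinearMap.zero_apply, map_zero]

/-- Every 1-cocycle of the BMS algebra with values in bivectors is a coboundary. -/
theorem IsBicocycle.exists_eq_cobracketOf {δ : BMS4 𝕜 →ₗ[𝕜] ⋀[𝕜]^2 (BMS4 𝕜)}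
    (hδ : IsBicocycle δ) : ∃ r, δ = cobracketOf r := by
  obtain ⟨r₀, hr₀⟩ := hδ.exists_mixed
  have h₁ := hδ.sub_cobracketOf r₀
  have hsupp := h₁.not_moved hr₀
  obtain ⟨r₁, hr₁, hr₁'⟩ := h₁.exists_witt true (hsupp true)
  obtain ⟨r₂, hr₂, hr₂'⟩ := h₁.exists_witt false (hsupp false)
  refine ⟨r₀ + r₁ + r₂, sub_eq_zero.1 ?_⟩
  refine (hδ.sub_cobracketOf _).eq_zero fun s m => ?_
  have h : ∀ x, (δ - cobracketOf (r₀ + r₁ + r₂)) x = (δ - cobracketOf r₀) x - ⁅x, r₁⁆ - ⁅x, r₂⁆ := by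
    intro x
    simp only [cobracketOf_add, LinearMap.sub_apply, LinearMap.add_apply, cobracketOf_apply]
    abel
  rw [h]
  -- The two Witt corrections do not interfere, since each is annihilated by the other Witt algebra.
  cases s with
  | true => rw [hr₁, show ⁅witt 𝕜 true m, r₂⁆ = 0 from hr₂' m, sub_self, sub_zero]
  | false => rw [hr₂, show ⁅witt 𝕜 false m, r₁⁆ = 0 from hr₁' m, sub_zero, sub_self]

theorem _root_.LieH1.subsingleton_H1 {R L M : Type*} [CommRing R] [LieRing L] [LieAlgebra R L]
    [AddCommGroup M] [Module R M] [LieRingModule L M] [LieModule R L M]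
    (h : LieH1.oneCocycle R L M ≤ LieH1.oneCoboundary R L M) : Subsingleton (LieH1.H1 R L M) :=
  Submodule.Quotient.subsingleton_iff.2 (Submodule.submoduleOf_eq_top.2 h)

theorem subsingleton_H1 : Subsingleton (LieH1.H1 𝕜 (BMS4 𝕜) (⋀[𝕜]^2 (BMS4 𝕜))) := by
  refine LieH1.subsingleton_H1 fun δ hδ => ?_
  rw [LieH1.mem_oneCocycle_iff] at hδ
  obtain ⟨r, hr⟩ := IsBicocycle.exists_eq_cobracketOf hδ
  exact ⟨r, hr.symm⟩

theorem eq_of_cobracketOf_eq {r r' : ⋀[𝕜]^2 (BMS4 𝕜)} (h : cobracketOf r = cobracketOf r') :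
    r = r' :=
  sub_eq_zero.1 <| exteriorPower_eq_zero_of_invariant fun s m => by
    rw [lie_sub, sub_eq_zero]
    exact LinearMap.congr_fun h _

end BMS4

theorem mainTheorem4 (𝕜 : Type*) [RCLike 𝕜] :
    Subsingleton (LieH1.H1 𝕜 (BMS4 𝕜) (⋀[𝕜]^2 (BMS4 𝕜))) ∧
    (∀ ω : ⋀[𝕜]^2 (BMS4 𝕜), (∀ x : BMS4 𝕜, ⁅x, ω⁆ = 0) → ω = 0) ∧
    (∀ ω : ⋀[𝕜]^3 (BMS4 𝕜), (∀ x : BMS4 𝕜, ⁅x, ω⁆ = 0) → ω = 0) ∧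
    (∀ δ : BMS4 𝕜 →ₗ[𝕜] ⋀[𝕜]^2 (BMS4 𝕜), LieBialg.IsCobracket δ →
      ∃ r : ⋀[𝕜]^2 (BMS4 𝕜), LieBialg.IsTriangular r ∧ δ = LieBialg.cobracketOf r ∧
        ∀ r' : ⋀[𝕜]^2 (BMS4 𝕜), δ = LieBialg.cobracketOf r' → r' = r) ∧
    (∀ r : ⋀[𝕜]^2 (BMS4 𝕜), LieBialg.IsTriangular r →
      LieBialg.IsCobracket (LieBialg.cobracketOf r)) ∧
    (∀ r₁ r₂ : ⋀[𝕜]^2 (BMS4 𝕜), LieBialg.IsTriangular r₁ → LieBialg.IsTriangular r₂ →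
      (LieBialg.Isomorphic (LieBialg.cobracketOf r₁) (LieBialg.cobracketOf r₂) ↔
        ∃ φ : BMS4 𝕜 ≃ₗ⁅𝕜⁆ BMS4 𝕜,
          exteriorPower.map 2 (φ : BMS4 𝕜 →ₗ[𝕜] BMS4 𝕜) r₁ = r₂)) := by
  refine ⟨BMS4.subsingleton_H1,
    fun ω h => BMS4.exteriorPower_eq_zero_of_invariant fun s m => h _,
    fun ω h => BMS4.exteriorPower_eq_zero_of_invariant fun s m => h _, fun δ hδ => ?_,
    fun r hr => ⟨LieBialg.cobracketOf_cocycle r, fun x => ?_⟩, fun r₁ r₂ _ _ =>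
      LieBialg.isomorphic_cobracketOf_iff
        (fun ω h => BMS4.exteriorPower_eq_zero_of_invariant fun s m => h _) r₁ r₂⟩
  · obtain ⟨r, rfl⟩ := BMS4.IsBicocycle.exists_eq_cobracketOf hδ.cocycle
    refine ⟨r, BMS4.tensorCube_eq_zero_of_invariant fun s m => ?_, rfl,
      fun r' h => (BMS4.eq_of_cobracketOf_eq h).symm⟩
    have h := hδ.coJacobi (BMS4.witt 𝕜 s m)
    rwa [LieBialg.cycl_cobracketOf, neg_eq_zero] at h
  · rw [LieBialg.cycl_cobracketOf, show LieBialg.schouten r = 0 from hr, lie_zero, neg_zero]
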